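/- Let $X=\{X(s,t):(s,t)\in[0,1]^2\}$ and $\epsilon=\{\epsilon(s):s\in[0,1]\}$ be real, jointly measurable, mean-zero processes with finite second moments at every point, where $c((s,t),(s',t'))=\mathrm{cov}\{X(s,t),X(s',t')\}$ is continuous; let $\Gamma(s,s')=\mathrm{cov}\{\epsilon(s),\epsilon(s')\}$. Let $X_1,X_2,\dots$ be iid copies of $X$, let $\epsilon_{1,ij}$ ($i,j\ge1$) be iid copies of $\epsilon$, and let $T_{ij}$ ($i,j\ge 1$) be iid random variables in $[0,1]$ with density $g$; the families $(X_i)$, $(T_{ij})$, $(\epsilon_{1,ij})$ are mutually independent. Subject $i$ has $m_i\ge1$ visits, where the numbers $m_i$ are non-random and satisfy $\sum_{i\le n}m_i^2/(\sum_{i\le n}m_i)^2\to0$ as $n\to\infty$ (for instance, the $m_i$ are bounded). For $1\le j\le m_i$ one observes the curves $$Y_{ij}(s)=W_i(s,T_{ij})=X_i(s,T_{ij})+\epsilon_{1,ij}(s),\qquad s\in[0,1].$$ Put $\Sigma(s,s')=\int_0^1 c((s,t),(s',t))\,g(t)\,dt$, $\Xi=\Sigma+\Gamma$, and $$\widehat\Xi(s,s')=\widehat\Xi_n(s,s')=\frac{\sum_{i=1}^n\sum_{j=1}^{m_i}Y_{ij}(s)Y_{ij}(s')}{\sum_{i=1}^n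 m_i}.$$ Assume $\mathrm E\iint X^2(s,t)\,ds\,dt<\infty$, that $g$ is continuous and bounded, and $\mathrm E\int\epsilon^2(s)\,ds<\infty$. (a) If $X(s,t)X(s',t)X(s,t')X(s',t')$ is integrable for all $s,s',t,t'$, then for each $(s,s')$, $|\widehat\Xi(s,s')-\Xi(s,s')|\to0$ in probability as $n\to\infty$. (b) If $\mathrm E\|X(\cdot,t)\|_{L^2[0,1]}^4<\infty$ for each $t$ and $\mathrm E\|\epsilon\|_{L^2[0,1]}^4<\infty$, then $\{\iint(\widehat\Xi-\Xi)^2(s,s')\,ds\,ds'\}^{1/2}\to0$ in probability as $n\to\infty$. (c) Under the assumptions of (b), let $(\lambda_k,\phi_k)_{k\ge1}$, with $\lambda_1\ge\lambda_2\ge\dots\ge0$ and $(\phi_k)$ orthonormal in $L^2[0,1]$, be the eigenvalues and eigenfunctions of the integral operator with kernel $\Xi$, all positive eigenvalues being listed with their multiplicities; let $(\widehat\lambda_k,\widehat\phi_k)_{k\ge1}$ be (almost surely, for each $n$) the same for $\widehat\Xi$. Let $k$ be such that $\lambda_k$ is a simple eigenvalue ($\lambda_l\neq\lambda_k$ for $l\neq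 k$), and let the sign of $\widehat\phi_k$ be chosen such that $\int\widehat\phi_k\phi_k\ge0$. Let $\xi_{W,ijk}=\int W_i(s,T_{ij})\phi_k(s)\,ds$ be the scores and $\widetilde\xi_{W,ijk}=\int Y_{ij}(s)\widehat\phi_k(s)\,ds$ the proxy scores. Then for each $i$, $$\sup_{1\le j\le m_i}|\widetilde\xi_{W,ijk}-\xi_{W,ijk}|\to0\quad\text{in probability as } n\to\infty.$$ -/

import Mathlib

open MeasureTheory ProbabilityTheory Filter Topology
open scoped ENNReal

noncomputable section

/-- The model for response curves observed with smooth error,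
`Y_ij(s) = X_i(s, T_ij) + ε_ij(s)` for `s ∈ [0,1]`, with mean zero.

`X` and `e` are the generic (jointly measurable) processes, defined on probability spaces
`(𝓧, PX)` and `(𝓔, PE)`. The `i`-th subject's process is the copy `X (x i ω)`, and the `j`-th error
curve of subject `i` is the copy `e (ε i j ω)`; `T i j` are the visit times, with density `g`
on `[0,1]`, and `m i` is the number of visits of subject `i`. -/
structure LongitudinalModel {Ω 𝓧 𝓔 : Type*}
    [MeasurableSpace Ω] [MeasurableSpace 𝓧] [MeasurableSpace 𝓔]
    (μ : Measure Ω) (PX : Measure 𝓧) (PE : Measure 𝓔)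
    (X : 𝓧 → unitInterval → unitInterval → ℝ) (e : 𝓔 → unitInterval → ℝ)
    (g : unitInterval → ℝ) (m : ℕ → ℕ)
    (x : ℕ → Ω → 𝓧) (T : ℕ → ℕ → Ω → unitInterval) (ε : ℕ → ℕ → Ω → 𝓔) : Prop where
  /-- The process `X(s,t)` is jointly measurable, has second moments, and mean zero. -/
  measurable_X : Measurable fun p : 𝓧 × unitInterval × unitInterval => X p.1 p.2.1 p.2.2
  memLp_X : ∀ s t, MemLp (fun u => X u s t) 2 PX
  mean_X : ∀ s t, ∫ u, X u s t ∂PX = 0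
  /-- The covariance function of `X` is continuous. -/
  continuous_cov : Continuous fun p : (unitInterval × unitInterval) × unitInterval × unitInterval =>
    cov[fun u => X u p.1.1 p.1.2, fun u => X u p.2.1 p.2.2; PX]
  /-- The error process `e(s)` is jointly measurable, has second moments, and mean zero. -/
  measurable_e : Measurable fun p : 𝓔 × unitInterval => e p.1 p.2
  memLp_e : ∀ s, MemLp (fun v => e v s) 2 PE
  mean_e : ∀ s, ∫ v, e v s ∂PE = 0
  /-- `X_i` are iid copies of `X`. -/
  measurable_x : ∀ i, Measurable (x i)
  map_x : ∀ i, μ.map (x i) = PX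
  indep_x : iIndepFun x μ
  /-- `ε_ij` are iid copies of `e`. -/
  measurable_ε : ∀ i j, Measurable (ε i j)
  map_ε : ∀ i j, μ.map (ε i j) = PE
  indep_ε : iIndepFun (fun p : ℕ × ℕ => ε p.1 p.2) μ
  /-- The visit times are iid with density `g`. -/
  g_nonneg : ∀ t, 0 ≤ g t
  measurable_T : ∀ i j, Measurable (T i j)
  map_T : ∀ i j, μ.map (T i j) = (volume : Measure unitInterval).withDensity
    fun t => ENNReal.ofReal (g t)
  indep_T : iIndepFun (fun p : ℕ × ℕ => T p.1 p.2) μ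
  /-- The processes `X_i`, the visit times, and the errors are independent of each other. -/
  indep_x_Tε : IndepFun (fun ω (i : ℕ) => x i ω)
    (fun ω (p : ℕ × ℕ) => (T p.1 p.2 ω, ε p.1 p.2 ω)) μ
  indep_T_ε : IndepFun (fun ω (p : ℕ × ℕ) => T p.1 p.2 ω) (fun ω (p : ℕ × ℕ) => ε p.1 p.2 ω) μ
  /-- Sparse longitudinal design: every subject is seen, and no subject dominates the pooled
  sample, `∑ m_i² / (∑ m_i)² → 0` (in particular if the `m_i` are bounded). -/
  one_le_m : ∀ i, 1 ≤ m i
  sparse : Tendsto (fun n : ℕ =>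
    (∑ i ∈ Finset.range n, (m i : ℝ) ^ 2) / (∑ i ∈ Finset.range n, (m i : ℝ)) ^ 2) atTop (𝓝 0)

/-- The observed curve `Y_ij(s) = W_i(s, T_ij) = X_i(s, T_ij) + ε_ij(s)`. -/
def observedCurve {Ω 𝓧 𝓔 : Type*}
    (X : 𝓧 → unitInterval → unitInterval → ℝ) (e : 𝓔 → unitInterval → ℝ)
    (x : ℕ → Ω → 𝓧) (T : ℕ → ℕ → Ω → unitInterval) (ε : ℕ → ℕ → Ω → 𝓔)
    (i j : ℕ) (ω : Ω) (s : unitInterval) : ℝ :=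
  X (x i ω) s (T i j ω) + e (ε i j ω) s

/-- The pooled sample covariance
`(∑_{i<n} ∑_{j<m_i} Y_ij(s) Y_ij(s')) / ∑_{i<n} m_i` of the curves `Y`. -/
def pooledCov {Ω : Type*} (Y : ℕ → ℕ → Ω → unitInterval → ℝ) (m : ℕ → ℕ)
    (n : ℕ) (ω : Ω) (s s' : unitInterval) : ℝ :=
  (∑ i ∈ Finset.range n, ∑ j ∈ Finset.range (m i), Y i j ω s * Y i j ω s') /
    ∑ i ∈ Finset.range n, (m i : ℝ)

/-- The marginal covariance `Σ(s,s') = ∫ c((s,t),(s',t)) g(t) dt`, with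
`c((s,t),(s',t')) = cov(X(s,t), X(s',t'))`. -/
def marginalCov {𝓧 : Type*} [MeasurableSpace 𝓧] (PX : Measure 𝓧)
    (X : 𝓧 → unitInterval → unitInterval → ℝ) (g : unitInterval → ℝ) (s s' : unitInterval) : ℝ :=
  ∫ t, cov[fun u => X u s t, fun u => X u s' t; PX] * g t

/-- The error covariance `Γ(s,s') = cov(e(s), e(s'))`. -/
def errorCov {𝓔 : Type*} [MeasurableSpace 𝓔] (PE : Measure 𝓔)
    (e : 𝓔 → unitInterval → ℝ) (s s' : unitInterval) : ℝ :=
  cov[fun v => e v s, fun v => e v s'; PE]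

/-- `Ξ = Σ + Γ`. -/
def totalCov {𝓧 𝓔 : Type*} [MeasurableSpace 𝓧] [MeasurableSpace 𝓔]
    (PX : Measure 𝓧) (PE : Measure 𝓔)
    (X : 𝓧 → unitInterval → unitInterval → ℝ) (e : 𝓔 → unitInterval → ℝ)
    (g : unitInterval → ℝ) (s s' : unitInterval) : ℝ :=
  marginalCov PX X g s s' + errorCov PE e s s'

/-- The Hilbert–Schmidt norm `(∬ k²(s,s') ds ds')^{1/2}` of a kernel, with value `∞` when the
kernel is not square integrable. -/
def hsNorm (k : unitInterval → unitInterval → ℝ) : ℝ≥0∞ :=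
  (∫⁻ s, ∫⁻ s', ‖k s s'‖ₑ ^ 2) ^ (1 / 2 : ℝ)

/-- `(φ_k, lam_k)` is the spectral decomposition of the integral operator with kernel `K` on
`L²[0,1]`: the `φ_k` are orthonormal eigenfunctions with eigenvalues `lam_0 ≥ lam_1 ≥ … ≥ 0`, and
the operator vanishes on the orthogonal complement of the `φ_k` (which is `0` when the `φ_k` form
a basis), so that all positive eigenvalues are listed, with their multiplicities. -/
structure IsSpectralDecomposition (K : unitInterval → unitInterval → ℝ)
    (φ : ℕ → Lp ℝ 2 (volume : Measure unitInterval)) (lam : ℕ → ℝ) : Prop where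
  orthonormal : Orthonormal ℝ φ
  antitone : Antitone lam
  nonneg : ∀ k, 0 ≤ lam k
  eigen : ∀ k, ∀ᵐ s : unitInterval, ∫ s', K s s' * φ k s' = lam k * φ k s
  complete : ∀ f : Lp ℝ 2 (volume : Measure unitInterval), (∀ k, inner ℝ (φ k) f = 0) →
    ∀ᵐ s : unitInterval, ∫ s', K s s' * f s' = 0

/-- The score `∫ y(s) φ(s) ds` of a curve `y` in the direction `φ`. -/
def score (y : unitInterval → ℝ) (φ : Lp ℝ 2 (volume : Measure unitInterval)) : ℝ :=
  ∫ s, y s * φ s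

end

/-! The triples `(x i, T i j, ε i j)` all have one law `Q`, the product of `PX`, the visit time law
and `PE`. They are independent across subjects, while visits of one subject share `x i` and may be
dependent. So `pooledCov` is a cluster mean of the kernels `y ⊗ y` of the observed curves, and since
`X` and `e` are centred and independent, the `Q`-mean of `y ⊗ y` is `totalCov`.

The core is a weak law of large numbers for clustered arrays with values in `L²(ν)`, which asks only
for an integrable norm. The part of the array of norm at most `B` has mean square error at most `B²`
times `∑ m_i² / (∑ m_i)²`: covariances vanish between clusters, and within a cluster each is at most
the variance. The remainder and its expectation are each controlled by the tail of the integral of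
the norm, through the triangle inequality and Minkowski's integral inequality. Truncating at a large
fixed `B` and letting `n` grow gives convergence in mean, hence in probability. A Dirac `ν` yields
(a); Lebesgue measure on the square yields (b), because `‖y ⊗ y‖ = ‖y‖²` is integrable.

For (c), the Hilbert–Schmidt norm dominates the operator norm. Weyl's inequality controls the
eigenvalues, and the gap around a simple eigenvalue then bounds `‖φhat k - φ k‖` by a constant times
the Hilbert–Schmidt error. By Cauchy–Schwarz the score errors of subject `i` are at most `‖φhat k -
φ k‖` times a random factor not depending on `n`, which is tight. -/

noncomputable section

/-! ### Minkowski's integral inequality -/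

/-- Minkowski's integral inequality for the `L²` norm. -/
theorem eLpNorm_two_integral_le {α β : Type*} [MeasurableSpace α] [MeasurableSpace β]
    {Q : Measure α} {ν : Measure β} [SFinite Q] [SFinite ν] {G : α → β → ℝ}
    (hG : Measurable (Function.uncurry G)) :
    eLpNorm (fun p => ∫ z, G z p ∂Q) 2 ν ≤ ∫⁻ z, eLpNorm (G z) 2 ν ∂Q := by
  have hG1 : ∀ z, Measurable (G z) := fun z => hG.comp measurable_prodMk_left
  have hG2 : ∀ p, Measurable (fun z => G z p) := fun p => hG.comp measurable_prodMk_right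
  have holder : ∀ z z', ∫⁻ p, ‖G z p‖ₑ * ‖G z' p‖ₑ ∂ν ≤ eLpNorm (G z) 2 ν * eLpNorm (G z') 2 ν := by
    intro z z'
    have := ENNReal.lintegral_mul_le_Lp_mul_Lq ν Real.HolderConjugate.two_two
      (hG1 z).enorm.aemeasurable (hG1 z').enorm.aemeasurable
    simpa [eLpNorm_eq_lintegral_rpow_enorm_toReal] using this
  have hsq : ∫⁻ p, (∫⁻ z, ‖G z p‖ₑ ∂Q) ^ 2 ∂ν ≤ (∫⁻ z, eLpNorm (G z) 2 ν ∂Q) ^ 2 := by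
    have hm : Measurable fun p => ∫⁻ z, ‖G z p‖ₑ ∂Q := hG.enorm.lintegral_prod_left'
    have hN : Measurable fun z => eLpNorm (G z) 2 ν := by
      simp only [eLpNorm_eq_lintegral_rpow_enorm_toReal two_ne_zero ENNReal.ofNat_ne_top]
      exact ((hG.enorm.pow_const _).lintegral_prod_right').pow_const _
    -- The square is a double integral over `z` and `z'`; Tonelli brings the integral over `p`
    -- innermost, where Cauchy–Schwarz applies.
    calc ∫⁻ p, (∫⁻ z, ‖G z p‖ₑ ∂Q) ^ 2 ∂ν
        = ∫⁻ p, ∫⁻ z, ‖G z p‖ₑ * (∫⁻ z', ‖G z' p‖ₑ ∂Q) ∂Q ∂ν := by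
          refine lintegral_congr fun p => ?_
          rw [lintegral_mul_const _ (hG2 p).enorm, sq]
      _ = ∫⁻ z, ∫⁻ p, ‖G z p‖ₑ * (∫⁻ z', ‖G z' p‖ₑ ∂Q) ∂ν ∂Q := by
          refine lintegral_lintegral_swap (Measurable.aemeasurable ?_)
          exact (hG.enorm.comp measurable_swap).mul (hm.comp measurable_fst)
      _ = ∫⁻ z, ∫⁻ z', ∫⁻ p, ‖G z p‖ₑ * ‖G z' p‖ₑ ∂ν ∂Q ∂Q := by
          refine lintegral_congr fun z => ?_
          rw [lintegral_lintegral_swap]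
          · exact lintegral_congr fun p => (lintegral_const_mul _ (hG2 p).enorm).symm
          · refine Measurable.aemeasurable ?_
            exact ((hG1 z).enorm.comp measurable_snd).mul hG.enorm
      _ ≤ ∫⁻ z, ∫⁻ z', eLpNorm (G z) 2 ν * eLpNorm (G z') 2 ν ∂Q ∂Q :=
          lintegral_mono fun z => lintegral_mono fun z' => holder z z'
      _ = (∫⁻ z, eLpNorm (G z) 2 ν ∂Q) ^ 2 := by
          simp_rw [lintegral_const_mul _ hN]
          rw [lintegral_mul_const _ hN, sq]
  rw [eLpNorm_eq_lintegral_rpow_enorm_toReal two_ne_zero ENNReal.ofNat_ne_top]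
  simp only [ENNReal.toReal_ofNat, ENNReal.rpow_ofNat]
  rw [one_div, ENNReal.rpow_inv_le_iff two_pos, ENNReal.rpow_ofNat]
  refine le_trans (lintegral_mono fun p => ?_) hsq
  gcongr
  exact enorm_integral_le_lintegral_enorm _

/-! ### Weak law of large numbers for clustered arrays in `L²` -/

/-- The mean `(∑_{i<n} ∑_{j<m_i} f i j) / ∑_{i<n} m_i` of a clustered array. -/
def clusterMean (m : ℕ → ℕ) (n : ℕ) (f : ℕ → ℕ → ℝ) : ℝ :=
  (∑ i ∈ Finset.range n, ∑ j ∈ Finset.range (m i), f i j) / ∑ i ∈ Finset.range n, (m i : ℝ)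

/-- The relative size `∑ m_i² / (∑ m_i)²` of the clusters. -/
def clusterRatio (m : ℕ → ℕ) (n : ℕ) : ℝ :=
  (∑ i ∈ Finset.range n, (m i : ℝ) ^ 2) / (∑ i ∈ Finset.range n, (m i : ℝ)) ^ 2

section cluster

variable {m : ℕ → ℕ}

theorem sum_sizes_pos (hm : ∀ i, 1 ≤ m i) {n : ℕ} (hn : 1 ≤ n) :
    0 < ∑ i ∈ Finset.range n, (m i : ℝ) :=
  Finset.sum_pos (fun i _ => by exact_mod_cast hm i) (by simp; omega)

theorem clusterRatio_pos (hm : ∀ i, 1 ≤ m i) {n : ℕ} (hn : 1 ≤ n) : 0 < clusterRatio m n :=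
  div_pos (Finset.sum_pos (fun i _ => pow_pos (by exact_mod_cast hm i) 2) (by simp; omega))
    (pow_pos (sum_sizes_pos hm hn) 2)

theorem clusterMean_eq_sigma (m : ℕ → ℕ) (n : ℕ) (f : ℕ → ℕ → ℝ) :
    clusterMean m n f = (∑ i ∈ Finset.range n, (m i : ℝ))⁻¹ *
      ∑ p ∈ (Finset.range n).sigma fun i => Finset.range (m i), f p.1 p.2 := by
  rw [clusterMean, Finset.sum_sigma, div_eq_inv_mul]

theorem clusterMean_add (m : ℕ → ℕ) (n : ℕ) (f f' : ℕ → ℕ → ℝ) :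
    clusterMean m n (fun i j => f i j + f' i j) = clusterMean m n f + clusterMean m n f' := by
  simp only [clusterMean_eq_sigma, Finset.sum_add_distrib, mul_add]

theorem clusterMean_const (hm : ∀ i, 1 ≤ m i) {n : ℕ} (hn : 1 ≤ n) (c : ℝ) :
    clusterMean m n (fun _ _ => c) = c := by
  have := (sum_sizes_pos hm hn).ne'
  simp only [clusterMean, Finset.sum_const, Finset.card_range, nsmul_eq_mul, ← Finset.sum_mul]
  field_simp

variable {Ω E S : Type*} [MeasurableSpace Ω] [MeasurableSpace E] [MeasurableSpace S]
  {μ : Measure Ω} [IsProbabilityMeasure μ] {Q : Measure E} [IsProbabilityMeasure Q]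
  {ν : Measure S} [SFinite ν] {Z : ℕ → ℕ → Ω → E}

-- Follows from `0 ≤ Var(f(Z) - f(Z')) = 2 Var f - 2 cov`. Nothing is needed about the joint law, so
-- it applies to dependent visits within one cluster.
omit [IsProbabilityMeasure Q] in
theorem covariance_le_variance_of_measurePreserving {Z Z' : Ω → E}
    (hZ : MeasurePreserving Z μ Q) (hZ' : MeasurePreserving Z' μ Q) {f : E → ℝ}
    (hf : MemLp f 2 Q) :
    cov[fun ω => f (Z ω), fun ω => f (Z' ω); μ] ≤ Var[f; Q] := by
  have h1 : MemLp (fun ω => f (Z ω)) 2 μ := hf.comp_measurePreserving hZ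
  have h2 : MemLp (fun ω => f (Z' ω)) 2 μ := hf.comp_measurePreserving hZ'
  have h := variance_nonneg (fun ω => f (Z ω) - f (Z' ω)) μ
  rw [variance_fun_sub h1 h2, hZ.variance_fun_comp hf.aemeasurable,
    hZ'.variance_fun_comp hf.aemeasurable] at h
  linarith

/-- The mean square error of a cluster mean. -/
theorem lintegral_clusterMean_sub_sq_le (hm : ∀ i, 1 ≤ m i)
    (hZ : ∀ i j, MeasurePreserving (Z i j) μ Q)
    (hind : ∀ i i' j j', i ≠ i' → IndepFun (Z i j) (Z i' j') μ)
    {f : E → ℝ} (hf : Measurable f) {n : ℕ} (hn : 1 ≤ n) :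
    ∫⁻ ω, ‖clusterMean m n (fun i j => f (Z i j ω)) - ∫ z, f z ∂Q‖ₑ ^ 2 ∂μ ≤
      ENNReal.ofReal (clusterRatio m n) * ∫⁻ z, ‖f z‖ₑ ^ 2 ∂Q := by
  -- Positivity of the ratio matters here: it makes the right-hand side `∞` rather than `0 * ∞ = 0`.
  by_cases hfin : ∫⁻ z, ‖f z‖ₑ ^ 2 ∂Q = ∞
  · rw [hfin, ENNReal.mul_top (by simpa using clusterRatio_pos hm hn)]
    exact le_top
  have hL : MemLp f 2 Q := by
    refine ⟨hf.aestronglyMeasurable, ?_⟩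
    rw [eLpNorm_lt_top_iff_lintegral_rpow_enorm_lt_top two_ne_zero ENNReal.ofNat_ne_top]
    simpa [lt_top_iff_ne_top] using hfin
  set I := (Finset.range n).sigma fun i => Finset.range (m i)
  set M := ∑ i ∈ Finset.range n, (m i : ℝ) with hM
  have hMpos : 0 < M := sum_sizes_pos hm hn
  have hD : ∀ p : Σ _ : ℕ, ℕ, MemLp (fun ω => f (Z p.1 p.2 ω)) 2 μ :=
    fun p => hL.comp_measurePreserving (hZ p.1 p.2)
  set A : Ω → ℝ := fun ω => M⁻¹ * ∑ p ∈ I, f (Z p.1 p.2 ω)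
  have hA : MemLp A 2 μ := (memLp_finsetSum I fun p _ => hD p).const_mul _
  have hEA : ∫ ω, A ω ∂μ = ∫ z, f z ∂Q := by
    simp only [A]
    rw [integral_const_mul, integral_finsetSum _ fun p _ => (hD p).integrable (by norm_num)]
    have : ∀ p : Σ _ : ℕ, ℕ, ∫ ω, f (Z p.1 p.2 ω) ∂μ = ∫ z, f z ∂Q := by
      intro p
      rw [← (hZ p.1 p.2).map_eq, integral_map (hZ p.1 p.2).measurable.aemeasurable
        hf.aestronglyMeasurable]
    simp only [this]
    have h := clusterMean_const hm hn (∫ z, f z ∂Q)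
    rwa [clusterMean_eq_sigma] at h
  have hVar : Var[A; μ] ≤ clusterRatio m n * Var[f; Q] := by
    rw [variance_const_mul, variance_fun_sum' fun p _ => hD p]
    -- For a fixed visit `a` only its own cluster contributes, with `m a.1` covariances each at most
    -- the variance. Summing over `a` produces `∑ m_i²`.
    have hle : ∀ a ∈ I, ∑ b ∈ I, cov[fun ω => f (Z a.1 a.2 ω), fun ω => f (Z b.1 b.2 ω); μ] ≤
        m a.1 * Var[f; Q] := by
      intro a ha
      have ha' : a.1 ∈ Finset.range n := (Finset.mem_sigma.1 ha).1
      rw [Finset.sum_sigma, Finset.sum_eq_single_of_mem a.1 ha']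
      · calc _ ≤ ∑ _j ∈ Finset.range (m a.1), Var[f; Q] := Finset.sum_le_sum fun j _ =>
              covariance_le_variance_of_measurePreserving (hZ _ _) (hZ _ _) hL
          _ = _ := by simp
      · intro i _ hi
        refine Finset.sum_eq_zero fun j _ => ?_
        exact ((hind a.1 i a.2 j hi.symm).comp hf hf).covariance_eq_zero (hD a) (hD ⟨i, j⟩)
    calc _ ≤ (M⁻¹) ^ 2 * ∑ a ∈ I, m a.1 * Var[f; Q] := by gcongr with a ha; exact hle a ha
      _ = _ := by
        rw [Finset.sum_sigma, clusterRatio, ← hM]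
        simp only [Finset.sum_const, Finset.card_range, nsmul_eq_mul, ← mul_assoc,
          ← Finset.sum_mul, ← sq]
        field_simp
  have hVarle : Var[f; Q] ≤ ∫ z, f z ^ 2 ∂Q := variance_le_expectation_sq hL.1
  calc ∫⁻ ω, ‖clusterMean m n (fun i j => f (Z i j ω)) - ∫ z, f z ∂Q‖ₑ ^ 2 ∂μ
      = eVar[A; μ] := by
        simp only [evariance, clusterMean_eq_sigma, hEA, A, I, M]
    _ = ENNReal.ofReal Var[A; μ] := (ofReal_variance hA).symm
    _ ≤ ENNReal.ofReal (clusterRatio m n * ∫ z, f z ^ 2 ∂Q) := by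
        refine ENNReal.ofReal_le_ofReal (hVar.trans ?_)
        gcongr
        exact (clusterRatio_pos hm hn).le
    _ = _ := by
        rw [ENNReal.ofReal_mul (clusterRatio_pos hm hn).le,
          ofReal_integral_eq_lintegral_ofReal hL.integrable_sq (ae_of_all _ fun z => sq_nonneg _)]
        congr 1
        refine lintegral_congr fun z => ?_
        rw [← enorm_pow, Real.enorm_of_nonneg (sq_nonneg _)]

theorem measurable_eLpNorm_two {F : E → S → ℝ} (hF : Measurable (Function.uncurry F)) :
    Measurable fun z => eLpNorm (F z) 2 ν := by
  simp only [eLpNorm_eq_lintegral_rpow_enorm_toReal two_ne_zero ENNReal.ofNat_ne_top]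
  exact ((hF.enorm.pow_const _).lintegral_prod_right').pow_const _

omit [SFinite ν] in
theorem eLpNorm_two_sq {f : S → ℝ} : eLpNorm f 2 ν ^ 2 = ∫⁻ p, ‖f p‖ₑ ^ 2 ∂ν := by
  rw [eLpNorm_eq_lintegral_rpow_enorm_toReal two_ne_zero ENNReal.ofNat_ne_top,
    ← ENNReal.rpow_natCast, ← ENNReal.rpow_mul]
  simp

theorem measurable_uncurry_clusterMean {F : E → S → ℝ} (hF : Measurable (Function.uncurry F))
    (hZ : ∀ i j, Measurable (Z i j)) (n : ℕ) :
    Measurable (Function.uncurry fun ω p => clusterMean m n fun i j => F (Z i j ω) p) := by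
  unfold clusterMean
  refine Measurable.div_const ?_ _
  refine Finset.measurable_sum _ fun i _ => Finset.measurable_sum _ fun j _ => ?_
  exact hF.comp (((hZ i j).comp measurable_fst).prodMk measurable_snd)

theorem stronglyMeasurable_integral_left {F : E → S → ℝ}
    (hF : Measurable (Function.uncurry F)) : StronglyMeasurable fun p => ∫ z, F z p ∂Q :=
  StronglyMeasurable.integral_prod_left' (f := Function.uncurry F) hF.stronglyMeasurable

theorem measurable_uncurry_clusterMean_sub {F : E → S → ℝ} (hF : Measurable (Function.uncurry F))
    (hZ : ∀ i j, Measurable (Z i j)) (n : ℕ) :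
    Measurable (Function.uncurry fun ω p =>
      clusterMean m n (fun i j => F (Z i j ω) p) - ∫ z, F z p ∂Q) :=
  (measurable_uncurry_clusterMean hF hZ n).sub
    ((stronglyMeasurable_integral_left hF).measurable.comp measurable_snd)

/-- The mean `L²` error of the mean of a clustered array of bounded random functions. -/
theorem lintegral_eLpNorm_clusterMean_sub_le (hm : ∀ i, 1 ≤ m i)
    (hZ : ∀ i j, MeasurePreserving (Z i j) μ Q)
    (hind : ∀ i i' j j', i ≠ i' → IndepFun (Z i j) (Z i' j') μ)
    {F : E → S → ℝ} (hF : Measurable (Function.uncurry F)) {B : ℝ≥0∞}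
    (hB : ∀ z, eLpNorm (F z) 2 ν ≤ B) {n : ℕ} (hn : 1 ≤ n) :
    ∫⁻ ω, eLpNorm (fun p => clusterMean m n (fun i j => F (Z i j ω) p) - ∫ z, F z p ∂Q) 2 ν ∂μ ≤
      ENNReal.ofReal (clusterRatio m n) ^ (1 / 2 : ℝ) * B := by
  set D : Ω → S → ℝ := fun ω p => clusterMean m n (fun i j => F (Z i j ω) p) - ∫ z, F z p ∂Q
  have hD : Measurable (Function.uncurry D) :=
    measurable_uncurry_clusterMean_sub hF (fun i j => (hZ i j).measurable) n
  have hsq : ∫⁻ ω, eLpNorm (D ω) 2 ν ^ 2 ∂μ ≤ ENNReal.ofReal (clusterRatio m n) * B ^ 2 := by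
    calc ∫⁻ ω, eLpNorm (D ω) 2 ν ^ 2 ∂μ = ∫⁻ p, ∫⁻ ω, ‖D ω p‖ₑ ^ 2 ∂μ ∂ν := by
          simp only [eLpNorm_two_sq]
          exact lintegral_lintegral_swap (hD.enorm.pow_const 2).aemeasurable
      _ ≤ ∫⁻ p, ENNReal.ofReal (clusterRatio m n) * ∫⁻ z, ‖F z p‖ₑ ^ 2 ∂Q ∂ν :=
          lintegral_mono fun p => lintegral_clusterMean_sub_sq_le hm hZ hind
            (f := fun z => F z p) (hF.comp measurable_prodMk_right) hn
      _ = ENNReal.ofReal (clusterRatio m n) * ∫⁻ z, eLpNorm (F z) 2 ν ^ 2 ∂Q := by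
          rw [lintegral_const_mul' _ _ ENNReal.ofReal_ne_top]
          simp only [eLpNorm_two_sq]
          rw [lintegral_lintegral_swap ((hF.comp measurable_swap).enorm.pow_const 2).aemeasurable]
      _ ≤ ENNReal.ofReal (clusterRatio m n) * ∫⁻ _, B ^ 2 ∂Q := by
          gcongr with z
          exact hB z
      _ = _ := by simp
  -- Cauchy–Schwarz against the constant `1` passes from the mean square to the mean.
  have hcs := ENNReal.lintegral_mul_le_Lp_mul_Lq μ Real.HolderConjugate.two_two
    (measurable_eLpNorm_two hD (ν := ν)).aemeasurable (aemeasurable_const (b := (1 : ℝ≥0∞)))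
  simp only [Pi.mul_apply, mul_one, lintegral_const, measure_univ, ENNReal.rpow_ofNat, one_pow,
    ENNReal.one_rpow] at hcs
  refine hcs.trans ((ENNReal.rpow_le_rpow hsq (by norm_num : (0 : ℝ) ≤ 1 / 2)).trans_eq ?_)
  rw [ENNReal.mul_rpow_of_nonneg _ _ (by norm_num), ← ENNReal.rpow_natCast B, ← ENNReal.rpow_mul]
  norm_num

omit [IsProbabilityMeasure μ] [IsProbabilityMeasure Q] in
/-- The mean `L²` norm of the mean of a clustered array of random functions. -/
theorem lintegral_eLpNorm_clusterMean_le (hm : ∀ i, 1 ≤ m i)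
    (hZ : ∀ i j, MeasurePreserving (Z i j) μ Q)
    {F : E → S → ℝ} (hF : Measurable (Function.uncurry F)) {n : ℕ} (hn : 1 ≤ n) :
    ∫⁻ ω, eLpNorm (fun p => clusterMean m n (fun i j => F (Z i j ω) p)) 2 ν ∂μ ≤
      ∫⁻ z, eLpNorm (F z) 2 ν ∂Q := by
  set I := (Finset.range n).sigma fun i => Finset.range (m i)
  set M := ∑ i ∈ Finset.range n, (m i : ℝ)
  have hMpos : 0 < M := sum_sizes_pos hm hn
  have hN : Measurable fun z => eLpNorm (F z) 2 ν := measurable_eLpNorm_two hF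
  have hle : ∀ ω, eLpNorm (fun p => clusterMean m n (fun i j => F (Z i j ω) p)) 2 ν ≤
      ENNReal.ofReal M⁻¹ * ∑ p ∈ I, eLpNorm (F (Z p.1 p.2 ω)) 2 ν := by
    intro ω
    have h : (fun p => clusterMean m n (fun i j => F (Z i j ω) p)) =
        M⁻¹ • ∑ q ∈ I, F (Z q.1 q.2 ω) := by
      ext p
      simp [clusterMean_eq_sigma, I, M]
    rw [h, eLpNorm_const_smul, Real.enorm_of_nonneg (inv_nonneg.2 hMpos.le)]
    gcongr
    exact eLpNorm_sum_le (fun q _ => (hF.comp measurable_prodMk_left).aestronglyMeasurable)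
      (by norm_num)
  refine (lintegral_mono hle).trans_eq ?_
  rw [lintegral_const_mul' _ _ ENNReal.ofReal_ne_top, lintegral_finsetSum I
    (f := fun q ω => eLpNorm (F (Z q.1 q.2 ω)) 2 ν) fun q _ => hN.comp (hZ q.1 q.2).measurable]
  have : ∀ q : Σ _ : ℕ, ℕ, ∫⁻ ω, eLpNorm (F (Z q.1 q.2 ω)) 2 ν ∂μ = ∫⁻ z, eLpNorm (F z) 2 ν ∂Q :=
    fun q => (hZ q.1 q.2).lintegral_comp hN
  simp only [this, Finset.sum_const, nsmul_eq_mul, ← mul_assoc]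
  have hcard : ((I.card : ℕ) : ℝ≥0∞) = ENNReal.ofReal M := by
    rw [← ENNReal.ofReal_natCast]
    simp [I, M]
  rw [hcard, ← ENNReal.ofReal_mul (inv_nonneg.2 hMpos.le), inv_mul_cancel₀ hMpos.ne']
  simp

/-- The mean `L²` error of a clustered mean, in terms of a bounded part and a remainder. -/
theorem lintegral_eLpNorm_clusterMean_sub_le_of_add (hm : ∀ i, 1 ≤ m i)
    (hZ : ∀ i j, MeasurePreserving (Z i j) μ Q)
    (hind : ∀ i i' j j', i ≠ i' → IndepFun (Z i j) (Z i' j') μ)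
    {F F₁ F₂ : E → S → ℝ} (hF₁m : Measurable (Function.uncurry F₁))
    (hF₂m : Measurable (Function.uncurry F₂)) (hsum : ∀ z p, F z p = F₁ z p + F₂ z p)
    (hint₁ : ∀ p, Integrable (fun z => F₁ z p) Q) (hint₂ : ∀ p, Integrable (fun z => F₂ z p) Q)
    {B : ℝ≥0∞} (hB₁ : ∀ z, eLpNorm (F₁ z) 2 ν ≤ B) {n : ℕ} (hn : 1 ≤ n) :
    ∫⁻ ω, eLpNorm (fun p => clusterMean m n (fun i j => F (Z i j ω) p) - ∫ z, F z p ∂Q) 2 ν ∂μ ≤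
      ENNReal.ofReal (clusterRatio m n) ^ (1 / 2 : ℝ) * B +
        (∫⁻ z, eLpNorm (F₂ z) 2 ν ∂Q + ∫⁻ z, eLpNorm (F₂ z) 2 ν ∂Q) := by
  have hΞ₂ : AEStronglyMeasurable (fun p => ∫ z, F₂ z p ∂Q) ν :=
    (stronglyMeasurable_integral_left hF₂m).aestronglyMeasurable
  have hA : ∀ ω, AEStronglyMeasurable (fun p => clusterMean m n fun i j => F₂ (Z i j ω) p) ν :=
    fun ω => ((measurable_uncurry_clusterMean hF₂m (fun i j => (hZ i j).measurable) n).comp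
      measurable_prodMk_left).aestronglyMeasurable
  have hD := measurable_uncurry_clusterMean_sub (m := m) (Q := Q) hF₁m
    (fun i j => (hZ i j).measurable) n
  have hpt : ∀ ω, eLpNorm
      (fun p => clusterMean m n (fun i j => F (Z i j ω) p) - ∫ z, F z p ∂Q) 2 ν ≤
      eLpNorm (fun p => clusterMean m n (fun i j => F₁ (Z i j ω) p) - ∫ z, F₁ z p ∂Q) 2 ν +
      (eLpNorm (fun p => clusterMean m n (fun i j => F₂ (Z i j ω) p)) 2 ν +
      eLpNorm (fun p => ∫ z, F₂ z p ∂Q) 2 ν) := by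
    intro ω
    have : (fun p => clusterMean m n (fun i j => F (Z i j ω) p) - ∫ z, F z p ∂Q) =
        (fun p => clusterMean m n (fun i j => F₁ (Z i j ω) p) - ∫ z, F₁ z p ∂Q) +
        ((fun p => clusterMean m n (fun i j => F₂ (Z i j ω) p)) - fun p => ∫ z, F₂ z p ∂Q) := by
      ext p
      simp only [hsum, clusterMean_add, integral_add (hint₁ p) (hint₂ p), Pi.add_apply,
        Pi.sub_apply]
      ring
    rw [this]
    have hDω : AEStronglyMeasurable
        (fun p => clusterMean m n (fun i j => F₁ (Z i j ω) p) - ∫ z, F₁ z p ∂Q) ν :=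
      (hD.of_uncurry_left (x := ω)).aestronglyMeasurable
    exact (eLpNorm_add_le hDω ((hA ω).sub hΞ₂) one_le_two).trans
      (add_le_add le_rfl (eLpNorm_sub_le (hA ω) hΞ₂ one_le_two))
  refine (lintegral_mono hpt).trans ?_
  rw [lintegral_add_left (measurable_eLpNorm_two hD), lintegral_add_right _ measurable_const]
  refine add_le_add ?_ (add_le_add ?_ ?_)
  · exact lintegral_eLpNorm_clusterMean_sub_le hm hZ hind hF₁m hB₁ hn
  · exact lintegral_eLpNorm_clusterMean_le hm hZ hF₂m hn
  · rw [lintegral_const, measure_univ, mul_one]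
    exact eLpNorm_two_integral_le hF₂m

/-- The weak law of large numbers in mean for the clustered means of random elements of `L²(ν)`
with integrable norm. -/
theorem tendsto_lintegral_eLpNorm_clusterMean_sub (hm : ∀ i, 1 ≤ m i)
    (hsparse : Tendsto (clusterRatio m) atTop (𝓝 0))
    (hZ : ∀ i j, MeasurePreserving (Z i j) μ Q)
    (hind : ∀ i i' j j', i ≠ i' → IndepFun (Z i j) (Z i' j') μ)
    {F : E → S → ℝ} (hF : Measurable (Function.uncurry F))
    (hint : ∀ p, Integrable (fun z => F z p) Q)
    (hN : ∫⁻ z, eLpNorm (F z) 2 ν ∂Q ≠ ∞) :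
    Tendsto (fun n => ∫⁻ ω, eLpNorm
      (fun p => clusterMean m n (fun i j => F (Z i j ω) p) - ∫ z, F z p ∂Q) 2 ν ∂μ)
      atTop (𝓝 0) := by
  have hNm : Measurable fun z => eLpNorm (F z) 2 ν := measurable_eLpNorm_two hF
  -- Markov's inequality makes the tail sets small, and absolute continuity of the integral does the
  -- rest.
  have htail : Tendsto (fun B : ℕ => ∫⁻ z in {z | (B : ℝ≥0∞) < eLpNorm (F z) 2 ν},
      eLpNorm (F z) 2 ν ∂Q) atTop (𝓝 0) := by
    refine tendsto_setLIntegral_zero hN ?_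
    have hbound : ∀ B : ℕ, Q {z | (B : ℝ≥0∞) < eLpNorm (F z) 2 ν} ≤
        (∫⁻ z, eLpNorm (F z) 2 ν ∂Q) / B := by
      intro B
      -- At `B = 0` the bound is `∞`, except when the integral vanishes: then it is `0 / 0 = 0`, and
      -- the norm is zero almost everywhere.
      rcases Nat.eq_zero_or_pos B with rfl | hB
      · by_cases h0 : ∫⁻ z, eLpNorm (F z) 2 ν ∂Q = 0
        · rw [lintegral_eq_zero_iff hNm] at h0
          refine le_of_eq_of_le (measure_eq_zero_iff_ae_notMem.2 ?_) zero_le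
          filter_upwards [h0] with z hz
          simpa using hz
        · simp [ENNReal.div_zero h0]
      · refine (measure_mono fun z hz => ?_).trans (meas_ge_le_lintegral_div hNm.aemeasurable
          (by simpa using hB.ne') (by simp))
        exact (Set.mem_ofPred.1 hz).le
    refine tendsto_of_tendsto_of_tendsto_of_le_of_le tendsto_const_nhds ?_
      (fun _ => zero_le) hbound
    have := ENNReal.Tendsto.const_mul (a := ∫⁻ z, eLpNorm (F z) 2 ν ∂Q)
      ENNReal.tendsto_inv_nat_nhds_zero (Or.inr hN)
    simpa [div_eq_mul_inv] using this
  rw [ENNReal.tendsto_nhds_zero]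
  intro δ hδ
  -- The remainder enters twice, through its cluster mean and through its expectation, at `δ / 4`
  -- each; `δ / 2` is left for the truncated part. The level `B` is fixed before `n`.
  have hδ4 : 0 < δ / 4 := ENNReal.div_pos hδ.ne' (by norm_num)
  obtain ⟨B, hB⟩ := (ENNReal.tendsto_nhds_zero.1 htail (δ / 4) hδ4).exists
  have hρ : Tendsto (fun n => ENNReal.ofReal (clusterRatio m n) ^ (1 / 2 : ℝ) * B) atTop
      (𝓝 0) := by
    have h1 : Tendsto (fun n => ENNReal.ofReal (clusterRatio m n) ^ (1 / 2 : ℝ)) atTop (𝓝 0) := by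
      have := ((ENNReal.continuous_rpow_const (y := (1 / 2 : ℝ))).tendsto 0).comp
        (by simpa using ENNReal.tendsto_ofReal hsparse)
      rwa [ENNReal.zero_rpow_of_pos (by norm_num)] at this
    simpa using ENNReal.Tendsto.mul_const h1 (Or.inr (ENNReal.natCast_ne_top B))
  filter_upwards [ENNReal.tendsto_nhds_zero.1 hρ (δ / 2) (ENNReal.half_pos hδ.ne'),
    eventually_ge_atTop 1] with n hnρ hn
  set tail : Set E := {z | (B : ℝ≥0∞) < eLpNorm (F z) 2 ν}
  have htm : MeasurableSet tail := measurableSet_lt measurable_const hNm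
  set F₁ : E → S → ℝ := tailᶜ.indicator F
  set F₂ : E → S → ℝ := tail.indicator F
  have hF₁m : Measurable (Function.uncurry F₁) := by
    have : Function.uncurry F₁ = (Prod.fst ⁻¹' tailᶜ).indicator (Function.uncurry F) := by
      ext ⟨z, p⟩
      by_cases hz : z ∈ tail <;> simp [F₁, Set.indicator, hz]
    rw [this]
    exact hF.indicator (measurable_fst htm.compl)
  have hF₂m : Measurable (Function.uncurry F₂) := by
    have : Function.uncurry F₂ = (Prod.fst ⁻¹' tail).indicator (Function.uncurry F) := by
      ext ⟨z, p⟩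
      by_cases hz : z ∈ tail <;> simp [F₂, Set.indicator, hz]
    rw [this]
    exact hF.indicator (measurable_fst htm)
  have hsum : ∀ z p, F z p = F₁ z p + F₂ z p := by
    intro z p
    by_cases hz : z ∈ tail <;> simp [F₁, F₂, hz]
  have hint₁ : ∀ p, Integrable (fun z => F₁ z p) Q := by
    intro p
    have : (fun z => F₁ z p) = tailᶜ.indicator fun z => F z p := by
      ext z
      by_cases hz : z ∈ tail <;> simp [F₁, Set.indicator, hz]
    rw [this]
    exact (hint p).indicator htm.compl
  have hint₂ : ∀ p, Integrable (fun z => F₂ z p) Q := by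
    intro p
    have : (fun z => F₂ z p) = tail.indicator fun z => F z p := by
      ext z
      by_cases hz : z ∈ tail <;> simp [F₂, Set.indicator, hz]
    rw [this]
    exact (hint p).indicator htm
  have hB₁ : ∀ z, eLpNorm (F₁ z) 2 ν ≤ B := by
    intro z
    by_cases hz : z ∈ tail
    · simp [F₁, hz]
    · have h1 : F₁ z = F z := by simp [F₁, hz]
      rw [h1]
      exact not_lt.1 hz
  have hr₂ : ∫⁻ z, eLpNorm (F₂ z) 2 ν ∂Q ≤ δ / 4 := by
    refine le_of_eq_of_le ?_ hB
    rw [← lintegral_indicator htm]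
    refine lintegral_congr fun z => ?_
    by_cases hz : z ∈ tail <;> simp [F₂, Set.indicator, hz]
  refine (lintegral_eLpNorm_clusterMean_sub_le_of_add hm hZ hind hF₁m hF₂m hsum hint₁ hint₂ hB₁
    hn).trans ((add_le_add hnρ (add_le_add hr₂ hr₂)).trans_eq ?_)
  have h4 : δ / 4 + δ / 4 = δ / 2 := by
    have : δ / 2 / 2 = δ / 4 := by
      rw [div_eq_mul_inv, div_eq_mul_inv, div_eq_mul_inv, mul_assoc,
        ← ENNReal.mul_inv (by simp) (by simp)]
      norm_num
    rw [← ENNReal.add_halves (δ / 2), this]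
  rw [h4, ENNReal.add_halves]

/-- The weak law of large numbers in probability for the clustered means of random elements of
`L²(ν)` with integrable norm. -/
theorem tendsto_measure_eLpNorm_clusterMean_sub (hm : ∀ i, 1 ≤ m i)
    (hsparse : Tendsto (clusterRatio m) atTop (𝓝 0))
    (hZ : ∀ i j, MeasurePreserving (Z i j) μ Q)
    (hind : ∀ i i' j j', i ≠ i' → IndepFun (Z i j) (Z i' j') μ)
    {F : E → S → ℝ} (hF : Measurable (Function.uncurry F))
    (hint : ∀ p, Integrable (fun z => F z p) Q)
    (hN : ∫⁻ z, eLpNorm (F z) 2 ν ∂Q ≠ ∞) {δ : ℝ≥0∞} (hδ : 0 < δ) :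
    Tendsto (fun n => μ {ω | δ ≤ eLpNorm
      (fun p => clusterMean m n (fun i j => F (Z i j ω) p) - ∫ z, F z p ∂Q) 2 ν})
      atTop (𝓝 0) := by
  -- Markov's inequality needs a finite threshold; the event for `∞` lies inside the event for `1`.
  wlog hδt : δ ≠ ∞ generalizing δ
  · rw [not_ne_iff] at hδt
    refine tendsto_of_tendsto_of_tendsto_of_le_of_le tendsto_const_nhds
      (this one_pos ENNReal.one_ne_top) (fun _ => zero_le) fun n => measure_mono fun ω hω => ?_
    exact le_trans (by simp [hδt]) (Set.mem_ofPred.1 hω)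
  have h := tendsto_lintegral_eLpNorm_clusterMean_sub hm hsparse hZ hind hF hint hN
  have hdiv : Tendsto (fun n => (∫⁻ ω, eLpNorm
      (fun p => clusterMean m n (fun i j => F (Z i j ω) p) - ∫ z, F z p ∂Q) 2 ν ∂μ) / δ)
      atTop (𝓝 0) := by
    simpa using ENNReal.Tendsto.div_const h (Or.inr hδ.ne')
  refine tendsto_of_tendsto_of_tendsto_of_le_of_le tendsto_const_nhds hdiv (fun _ => zero_le)
    fun n => ?_
  refine meas_ge_le_lintegral_div (Measurable.aemeasurable ?_) hδ.ne' hδt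
  exact measurable_eLpNorm_two
    (measurable_uncurry_clusterMean_sub hF (fun i j => (hZ i j).measurable) n)

end cluster

/-- The weak law of large numbers for the means of clustered arrays of integrable random
variables. -/
theorem tendstoInMeasure_clusterMean {m : ℕ → ℕ} {Ω E : Type*} [MeasurableSpace Ω]
    [MeasurableSpace E] {μ : Measure Ω} [IsProbabilityMeasure μ] {Q : Measure E}
    [IsProbabilityMeasure Q] {Z : ℕ → ℕ → Ω → E} (hm : ∀ i, 1 ≤ m i)
    (hsparse : Tendsto (clusterRatio m) atTop (𝓝 0))
    (hZ : ∀ i j, MeasurePreserving (Z i j) μ Q)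
    (hind : ∀ i i' j j', i ≠ i' → IndepFun (Z i j) (Z i' j') μ)
    {f : E → ℝ} (hf : Measurable f) (hint : Integrable f Q) :
    TendstoInMeasure μ (fun n ω => clusterMean m n fun i j => f (Z i j ω)) atTop
      fun _ => ∫ z, f z ∂Q := by
  -- Over a one-point space with Dirac mass the `L²` norm is the absolute value, so the scalar law
  -- is a case of the `L²` law.
  have hdirac : ∀ h : Unit → ℝ, eLpNorm h 2 (Measure.dirac ()) = ‖h ()‖ₑ := by
    intro h
    rw [eLpNorm_eq_lintegral_rpow_enorm_toReal two_ne_zero ENNReal.ofNat_ne_top, lintegral_dirac,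
      ← ENNReal.rpow_mul]
    simp
  intro δ hδ
  have h := tendsto_measure_eLpNorm_clusterMean_sub (ν := Measure.dirac ()) hm hsparse hZ hind
    (F := fun z _ => f z) (hf.comp measurable_fst) (fun _ => hint)
    (by simpa only [hdirac] using hint.2.ne) hδ
  simpa only [hdirac, ← edist_eq_enorm_sub] using h

/-! ### Independence of paired random elements -/

/-- Independence of the rows and of the columns of a `2 × 2` array of random elements. -/
theorem IndepFun.prodMk_transpose {Ω α₁ α₂ β₁ β₂ : Type*} [MeasurableSpace Ω]
    [MeasurableSpace α₁] [MeasurableSpace α₂] [MeasurableSpace β₁] [MeasurableSpace β₂]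
    {μ : Measure Ω} [IsProbabilityMeasure μ]
    {A₁ : Ω → α₁} {A₂ : Ω → α₂} {B₁ : Ω → β₁} {B₂ : Ω → β₂}
    (hA₁ : Measurable A₁) (hA₂ : Measurable A₂) (hB₁ : Measurable B₁) (hB₂ : Measurable B₂)
    (hAB : IndepFun (fun ω => (A₁ ω, A₂ ω)) (fun ω => (B₁ ω, B₂ ω)) μ)
    (hA : IndepFun A₁ A₂ μ) (hB : IndepFun B₁ B₂ μ) :
    IndepFun (fun ω => (A₁ ω, B₁ ω)) (fun ω => (A₂ ω, B₂ ω)) μ := by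
  have hAB₁ : IndepFun A₁ B₁ μ := hAB.comp measurable_fst measurable_fst
  have hAB₂ : IndepFun A₂ B₂ μ := hAB.comp measurable_snd measurable_snd
  refine IndepSets.indep (hA₁.prodMk hB₁).comap_le (hA₂.prodMk hB₂).comap_le
    ((isPiSystem_prod (α := α₁) (β := β₁)).comap fun ω => (A₁ ω, B₁ ω))
    ((isPiSystem_prod (α := α₂) (β := β₂)).comap fun ω => (A₂ ω, B₂ ω)) ?_ ?_ ?_
  · rw [← generateFrom_prod, MeasurableSpace.comap_generateFrom]
    rfl
  · rw [← generateFrom_prod, MeasurableSpace.comap_generateFrom]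
    rfl
  · rw [IndepSets_iff]
    rintro _ _ ⟨_, ⟨s, hs, u, hu, rfl⟩, rfl⟩ ⟨_, ⟨s', hs', u', hu', rfl⟩, rfl⟩
    simp only [Set.mem_ofPred_eq] at hs hu hs' hu'
    -- On rectangles the fourfold intersection is regrouped into an `A` event and a `B` event,
    -- factored completely, and recombined by index.
    have e1 : (fun ω => (A₁ ω, B₁ ω)) ⁻¹' s ×ˢ u ∩ (fun ω => (A₂ ω, B₂ ω)) ⁻¹' s' ×ˢ u' =
        (fun ω => (A₁ ω, A₂ ω)) ⁻¹' s ×ˢ s' ∩ (fun ω => (B₁ ω, B₂ ω)) ⁻¹' u ×ˢ u' := by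
      ext ω
      simp only [Set.mem_inter_iff, Set.mem_preimage, Set.mem_prod]
      tauto
    rw [e1, hAB.measure_inter_preimage_eq_mul _ _ (hs.prod hs') (hu.prod hu')]
    simp only [Set.mk_preimage_prod]
    rw [hA.measure_inter_preimage_eq_mul _ _ hs hs', hB.measure_inter_preimage_eq_mul _ _ hu hu',
      hAB₁.measure_inter_preimage_eq_mul _ _ hs hu, hAB₂.measure_inter_preimage_eq_mul _ _ hs' hu']
    ring

/-! ### Hilbert–Schmidt norms as `L²` norms on the square -/

theorem hsNorm_eq_eLpNorm {k : unitInterval → unitInterval → ℝ}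
    (hk : Measurable (Function.uncurry k)) :
    hsNorm k = eLpNorm (Function.uncurry k) 2 (volume.prod volume) := by
  rw [hsNorm, eLpNorm_eq_lintegral_rpow_enorm_toReal two_ne_zero ENNReal.ofNat_ne_top,
    lintegral_prod _ (hk.enorm.pow_const _).aemeasurable]
  simp [Function.uncurry]

/-- The `L²` norm of the tensor square of a function. -/
theorem eLpNorm_two_tensor_self {S : Type*} [MeasurableSpace S] {ν : Measure S} [SFinite ν]
    {y : S → ℝ} (hy : Measurable y) :
    eLpNorm (fun p : S × S => y p.1 * y p.2) 2 (ν.prod ν) = ∫⁻ s, ‖y s‖ₑ ^ 2 ∂ν := by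
  rw [eLpNorm_eq_lintegral_rpow_enorm_toReal two_ne_zero ENNReal.ofNat_ne_top]
  simp only [ENNReal.toReal_ofNat, ENNReal.rpow_ofNat, enorm_mul, mul_pow]
  rw [lintegral_prod_mul (hy.enorm.pow_const 2).aemeasurable (hy.enorm.pow_const 2).aemeasurable,
    ← sq, ← ENNReal.rpow_natCast, ← ENNReal.rpow_mul]
  simp

/-! ### Law and moments of a visit; consistency of the pooled covariance -/

namespace LongitudinalModel

variable {Ω 𝓧 𝓔 : Type*}
    [MeasurableSpace Ω] [MeasurableSpace 𝓧] [MeasurableSpace 𝓔]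
    {μ : Measure Ω} [IsProbabilityMeasure μ]
    {PX : Measure 𝓧} [IsProbabilityMeasure PX] {PE : Measure 𝓔} [IsProbabilityMeasure PE]
    {X : 𝓧 → unitInterval → unitInterval → ℝ} {e : 𝓔 → unitInterval → ℝ}
    {g : unitInterval → ℝ} {m : ℕ → ℕ}
    {x : ℕ → Ω → 𝓧} {T : ℕ → ℕ → Ω → unitInterval} {ε : ℕ → ℕ → Ω → 𝓔}

/-- The distribution of the visit times. -/
abbrev timeLaw (g : unitInterval → ℝ) : Measure unitInterval :=
  (volume : Measure unitInterval).withDensity fun t => ENNReal.ofReal (g t)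

/-- The joint distribution of a subject's process, a visit time and an error curve. -/
abbrev visitLaw (PX : Measure 𝓧) (PE : Measure 𝓔) (g : unitInterval → ℝ) :
    Measure (𝓧 × unitInterval × 𝓔) := PX.prod ((timeLaw g).prod PE)

/-- The curve `X(·, t) + e` observed at a visit. -/
def visitCurve (X : 𝓧 → unitInterval → unitInterval → ℝ) (e : 𝓔 → unitInterval → ℝ)
    (z : 𝓧 × unitInterval × 𝓔) (s : unitInterval) : ℝ := X z.1 s z.2.1 + e z.2.2 s

variable (hmodel : LongitudinalModel μ PX PE X e g m x T ε)
include hmodel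

omit [IsProbabilityMeasure PX] [IsProbabilityMeasure PE] in
theorem isProbabilityMeasure_timeLaw : IsProbabilityMeasure (timeLaw g) := by
  rw [timeLaw, ← hmodel.map_T 0 0]
  exact Measure.isProbabilityMeasure_map (hmodel.measurable_T 0 0).aemeasurable

omit [IsProbabilityMeasure PX] [IsProbabilityMeasure PE] in
theorem measurePreserving_visit (i j : ℕ) :
    MeasurePreserving (fun ω => (x i ω, T i j ω, ε i j ω)) μ (visitLaw PX PE g) := by
  have h1 : IndepFun (T i j) (ε i j) μ :=
    hmodel.indep_T_ε.comp (φ := fun f : ℕ × ℕ → unitInterval => f (i, j))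
      (ψ := fun f : ℕ × ℕ → 𝓔 => f (i, j)) (measurable_pi_apply _) (measurable_pi_apply _)
  have h2 : IndepFun (x i) (fun ω => (T i j ω, ε i j ω)) μ :=
    hmodel.indep_x_Tε.comp (φ := fun f : ℕ → 𝓧 => f i)
      (ψ := fun f : ℕ × ℕ → unitInterval × 𝓔 => f (i, j)) (measurable_pi_apply _)
      (measurable_pi_apply _)
  have mT := hmodel.measurable_T i j
  have mε := hmodel.measurable_ε i j
  have mx := hmodel.measurable_x i
  refine ⟨mx.prodMk (mT.prodMk mε), ?_⟩
  rw [(indepFun_iff_map_prod_eq_prod_map_map mx.aemeasurable (mT.prodMk mε).aemeasurable).1 h2,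
    (indepFun_iff_map_prod_eq_prod_map_map mT.aemeasurable mε.aemeasurable).1 h1,
    hmodel.map_x, hmodel.map_T, hmodel.map_ε]

-- Two transpositions: first times are paired with errors, then these pairs with the subject
-- processes. The second needs `x i` and `x i'` independent, whence `i ≠ i'`.
omit [IsProbabilityMeasure PX] [IsProbabilityMeasure PE] in
theorem indepFun_visit (i i' j j' : ℕ) (hi : i ≠ i') :
    IndepFun (fun ω => (x i ω, T i j ω, ε i j ω)) (fun ω => (x i' ω, T i' j' ω, ε i' j' ω)) μ := by
  have hne : (i, j) ≠ (i', j') := fun h => hi (congrArg Prod.fst h)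
  have hTε : IndepFun (fun ω => (T i j ω, T i' j' ω)) (fun ω => (ε i j ω, ε i' j' ω)) μ :=
    hmodel.indep_T_ε.comp (φ := fun f : ℕ × ℕ → unitInterval => (f (i, j), f (i', j')))
      (ψ := fun f : ℕ × ℕ → 𝓔 => (f (i, j), f (i', j')))
      ((measurable_pi_apply _).prodMk (measurable_pi_apply _))
      ((measurable_pi_apply _).prodMk (measurable_pi_apply _))
  have hx : IndepFun (fun ω => (x i ω, x i' ω))
      (fun ω => ((T i j ω, ε i j ω), (T i' j' ω, ε i' j' ω))) μ :=
    hmodel.indep_x_Tε.comp (φ := fun f : ℕ → 𝓧 => (f i, f i'))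
      (ψ := fun f : ℕ × ℕ → unitInterval × 𝓔 => (f (i, j), f (i', j')))
      ((measurable_pi_apply _).prodMk (measurable_pi_apply _))
      ((measurable_pi_apply _).prodMk (measurable_pi_apply _))
  have mT := hmodel.measurable_T
  have mε := hmodel.measurable_ε
  refine IndepFun.prodMk_transpose (hmodel.measurable_x i) (hmodel.measurable_x i')
    ((mT i j).prodMk (mε i j)) ((mT i' j').prodMk (mε i' j')) hx (hmodel.indep_x.indepFun hi) ?_
  exact IndepFun.prodMk_transpose (mT i j) (mT i' j') (mε i j) (mε i' j') hTε
    (hmodel.indep_T.indepFun hne) (hmodel.indep_ε.indepFun hne)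

omit [IsProbabilityMeasure μ] [IsProbabilityMeasure PX] [IsProbabilityMeasure PE] in
theorem measurable_visitCurve :
    Measurable (Function.uncurry (visitCurve X e)) := by
  have h1 : Measurable fun q : (𝓧 × unitInterval × 𝓔) × unitInterval => X q.1.1 q.2 q.1.2.1 :=
    hmodel.measurable_X.comp (measurable_fst.fst.prodMk
      (measurable_snd.prodMk measurable_fst.snd.fst))
  have h2 : Measurable fun q : (𝓧 × unitInterval × 𝓔) × unitInterval => e q.1.2.2 q.2 :=
    hmodel.measurable_e.comp (measurable_fst.snd.snd.prodMk measurable_snd)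
  exact h1.add h2

omit [IsProbabilityMeasure μ] [IsProbabilityMeasure PX] [IsProbabilityMeasure PE] in
theorem measurable_visitCurve_mul :
    Measurable (Function.uncurry fun (z : 𝓧 × unitInterval × 𝓔) (p : unitInterval × unitInterval) =>
      visitCurve X e z p.1 * visitCurve X e z p.2) :=
  (hmodel.measurable_visitCurve.comp (measurable_fst.prodMk measurable_snd.fst)).mul
    (hmodel.measurable_visitCurve.comp (measurable_fst.prodMk measurable_snd.snd))

omit [IsProbabilityMeasure μ] [IsProbabilityMeasure PX] [IsProbabilityMeasure PE] in
theorem cov_X_eq (s t s' t' : unitInterval) :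
    cov[fun u => X u s t, fun u => X u s' t'; PX] = ∫ u, X u s t * X u s' t' ∂PX := by
  simp [covariance, hmodel.mean_X]

omit [IsProbabilityMeasure μ] [IsProbabilityMeasure PX] [IsProbabilityMeasure PE] in
theorem errorCov_eq (s s' : unitInterval) :
    errorCov PE e s s' = ∫ v, e v s * e v s' ∂PE := by
  simp [errorCov, covariance, hmodel.mean_e]

-- The variance of `X(s, t)` is continuous in `t` on a compact interval, hence integrable against
-- the time law. This gives second moments at every `s`, whereas a bound on `E ∬ X²` would give them
-- only for almost every `s`.
omit [IsProbabilityMeasure PE] in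
theorem memLp_X_time (s : unitInterval) :
    MemLp (fun q : 𝓧 × unitInterval => X q.1 s q.2) 2 (PX.prod (timeLaw g)) := by
  have := hmodel.isProbabilityMeasure_timeLaw
  have hmeas : Measurable fun q : 𝓧 × unitInterval => X q.1 s q.2 :=
    hmodel.measurable_X.comp (measurable_fst.prodMk (measurable_const.prodMk measurable_snd))
  rw [memLp_two_iff_integrable_sq hmeas.aestronglyMeasurable,
    integrable_prod_iff' (hmeas.pow_const 2).aestronglyMeasurable]
  refine ⟨ae_of_all _ fun t => (hmodel.memLp_X s t).integrable_sq, ?_⟩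
  have hc : Continuous fun t => cov[fun u => X u s t, fun u => X u s t; PX] :=
    hmodel.continuous_cov.comp (f := fun t => ((s, t), (s, t))) (by fun_prop)
  have heq : (fun t => ∫ u, ‖X u s t ^ 2‖ ∂PX) =
      fun t => cov[fun u => X u s t, fun u => X u s t; PX] := by
    ext t
    rw [hmodel.cov_X_eq]
    exact integral_congr_ae (ae_of_all _ fun u => by simp [sq])
  rw [heq]
  exact hc.integrable_of_hasCompactSupport (HasCompactSupport.of_compactSpace _)

theorem memLp_X_visit (s : unitInterval) :
    MemLp (fun z : 𝓧 × unitInterval × 𝓔 => X z.1 s z.2.1) 2 (visitLaw PX PE g) := by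
  have := hmodel.isProbabilityMeasure_timeLaw
  exact (hmodel.memLp_X_time s).comp_measurePreserving
    ((MeasurePreserving.id PX).prod measurePreserving_fst)

theorem memLp_e_visit (s : unitInterval) :
    MemLp (fun z : 𝓧 × unitInterval × 𝓔 => e z.2.2 s) 2 (visitLaw PX PE g) := by
  have := hmodel.isProbabilityMeasure_timeLaw
  exact (hmodel.memLp_e s).comp_measurePreserving
    (measurePreserving_snd.comp measurePreserving_snd)

theorem memLp_visitCurve (s : unitInterval) :
    MemLp (fun z => visitCurve X e z s) 2 (visitLaw PX PE g) :=
  (hmodel.memLp_X_visit s).add (hmodel.memLp_e_visit s)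

theorem integral_X_mul_X_visit (hg : Continuous g) (s s' : unitInterval) :
    ∫ z, X z.1 s z.2.1 * X z.1 s' z.2.1 ∂(visitLaw PX PE g) = marginalCov PX X g s s' := by
  have := hmodel.isProbabilityMeasure_timeLaw
  have hmp : MeasurePreserving (fun z : 𝓧 × unitInterval × 𝓔 => (z.1, z.2.1)) (visitLaw PX PE g)
      (PX.prod (timeLaw g)) := (MeasurePreserving.id PX).prod measurePreserving_fst
  have hint : Integrable (fun q : 𝓧 × unitInterval => X q.1 s q.2 * X q.1 s' q.2)
      (PX.prod (timeLaw g)) := (hmodel.memLp_X_time s).integrable_mul (hmodel.memLp_X_time s')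
  have h1 := integral_map (μ := visitLaw PX PE g) hmp.measurable.aemeasurable
    (by rw [hmp.map_eq]; exact hint.1)
  rw [← h1, hmp.map_eq, integral_prod_symm _ hint, timeLaw,
    integral_withDensity_eq_integral_toReal_smul hg.measurable.ennreal_ofReal
      (ae_of_all _ fun _ => ENNReal.ofReal_lt_top), marginalCov]
  refine integral_congr_ae (ae_of_all _ fun t => ?_)
  simp only [hmodel.cov_X_eq, ENNReal.toReal_ofReal (hmodel.g_nonneg t), smul_eq_mul]
  ring

/-- With the time and the error fixed, integrating over the process first gives zero. -/
theorem integral_X_mul_e_visit (s s' : unitInterval) :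
    ∫ z, X z.1 s z.2.1 * e z.2.2 s' ∂(visitLaw PX PE g) = 0 := by
  have := hmodel.isProbabilityMeasure_timeLaw
  have hint : Integrable (fun z : 𝓧 × unitInterval × 𝓔 => X z.1 s z.2.1 * e z.2.2 s')
      (visitLaw PX PE g) := (hmodel.memLp_X_visit s).integrable_mul (hmodel.memLp_e_visit s')
  rw [integral_prod_symm _ hint]
  simp [integral_mul_const, hmodel.mean_X]

theorem integral_e_mul_e_visit (s s' : unitInterval) :
    ∫ z, e z.2.2 s * e z.2.2 s' ∂(visitLaw PX PE g) = errorCov PE e s s' := by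
  have := hmodel.isProbabilityMeasure_timeLaw
  have hmp : MeasurePreserving (fun z : 𝓧 × unitInterval × 𝓔 => z.2.2) (visitLaw PX PE g) PE :=
    measurePreserving_snd.comp measurePreserving_snd
  have hint : Integrable (fun v => e v s * e v s') PE :=
    (hmodel.memLp_e s).integrable_mul (hmodel.memLp_e s')
  have h1 := integral_map (μ := visitLaw PX PE g) hmp.measurable.aemeasurable
    (by rw [hmp.map_eq]; exact hint.1)
  rw [← h1, hmp.map_eq, hmodel.errorCov_eq]

/-- `Ξ(s,s') = E[Y(s) Y(s')]`. -/
theorem integral_visitCurve_mul (hg : Continuous g) (s s' : unitInterval) :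
    ∫ z, visitCurve X e z s * visitCurve X e z s' ∂(visitLaw PX PE g) =
      totalCov PX PE X e g s s' := by
  have hX := hmodel.memLp_X_visit
  have he := hmodel.memLp_e_visit
  have hexp : ∀ z : 𝓧 × unitInterval × 𝓔, visitCurve X e z s * visitCurve X e z s' =
      (X z.1 s z.2.1 * X z.1 s' z.2.1 + X z.1 s z.2.1 * e z.2.2 s') +
        (X z.1 s' z.2.1 * e z.2.2 s + e z.2.2 s * e z.2.2 s') := by
    intro z
    simp only [visitCurve]
    ring
  simp only [hexp]
  have i1 : Integrable (fun z : 𝓧 × unitInterval × 𝓔 => X z.1 s z.2.1 * X z.1 s' z.2.1)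
      (visitLaw PX PE g) := (hX s).integrable_mul (hX s')
  have i2 : ∀ s s', Integrable (fun z : 𝓧 × unitInterval × 𝓔 => X z.1 s z.2.1 * e z.2.2 s')
      (visitLaw PX PE g) := fun s s' => (hX s).integrable_mul (he s')
  have i3 : Integrable (fun z : 𝓧 × unitInterval × 𝓔 => e z.2.2 s * e z.2.2 s')
      (visitLaw PX PE g) := (he s).integrable_mul (he s')
  refine (integral_add (i1.add (i2 s s')) ((i2 s' s).add i3)).trans ?_
  simp only [Pi.add_apply]
  rw [integral_add i1 (i2 s s'), integral_add (i2 s' s) i3,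
    hmodel.integral_X_mul_X_visit hg, hmodel.integral_X_mul_e_visit,
    hmodel.integral_X_mul_e_visit, hmodel.integral_e_mul_e_visit, totalCov]
  ring

theorem integrable_visitCurve_mul (s s' : unitInterval) :
    Integrable (fun z => visitCurve X e z s * visitCurve X e z s') (visitLaw PX PE g) :=
  (hmodel.memLp_visitCurve s).integrable_mul (hmodel.memLp_visitCurve s')

/-- `E ‖Y‖² < ∞`. -/
theorem lintegral_visitCurve_sq_lt_top
    (hX2 : (∫⁻ u, (∫⁻ s, ∫⁻ t, ‖X u s t‖ₑ ^ 2) ∂PX) < ∞)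
    (hgb : BddAbove (Set.range fun t => |g t|))
    (he2 : (∫⁻ v, (∫⁻ s, ‖e v s‖ₑ ^ 2) ∂PE) < ∞) :
    ∫⁻ z, (∫⁻ s, ‖visitCurve X e z s‖ₑ ^ 2) ∂(visitLaw PX PE g) < ∞ := by
  have := hmodel.isProbabilityMeasure_timeLaw
  obtain ⟨C, hC⟩ := hgb
  -- A bounded density lets the integral over the random visit time be compared with `E ∬ X²`.
  have hle : timeLaw g ≤ ENNReal.ofReal C • volume := by
    rw [timeLaw, ← withDensity_const]
    refine withDensity_mono (ae_of_all _ fun t => ENNReal.ofReal_le_ofReal ?_)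
    exact (le_abs_self _).trans (hC ⟨t, rfl⟩)
  have mX : Measurable fun q : (𝓧 × unitInterval × 𝓔) × unitInterval => X q.1.1 q.2 q.1.2.1 :=
    hmodel.measurable_X.comp (measurable_fst.fst.prodMk
      (measurable_snd.prodMk measurable_fst.snd.fst))
  have hpt : ∀ z s, ‖visitCurve X e z s‖ₑ ^ 2 ≤
      2 * (‖X z.1 s z.2.1‖ₑ ^ 2 + ‖e z.2.2 s‖ₑ ^ 2) := by
    intro z s
    have h := ENNReal.rpow_add_le_mul_rpow_add_rpow ‖X z.1 s z.2.1‖ₑ ‖e z.2.2 s‖ₑ one_le_two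
    norm_num at h
    refine le_trans ?_ h
    gcongr
    exact enorm_add_le _ _
  have h1 : ∫⁻ z, (∫⁻ s, ‖X z.1 s z.2.1‖ₑ ^ 2) ∂(visitLaw PX PE g) < ∞ := by
    have mX' : Measurable fun q : (𝓧 × unitInterval) × unitInterval => ‖X q.1.1 q.2 q.1.2‖ₑ ^ 2 :=
      (hmodel.measurable_X.comp (measurable_fst.fst.prodMk
        (measurable_snd.prodMk measurable_fst.snd))).enorm.pow_const 2
    have hmp : MeasurePreserving (fun z : 𝓧 × unitInterval × 𝓔 => (z.1, z.2.1)) (visitLaw PX PE g)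
        (PX.prod (timeLaw g)) := (MeasurePreserving.id PX).prod measurePreserving_fst
    have h := hmp.lintegral_comp (f := fun q => ∫⁻ s, ‖X q.1 s q.2‖ₑ ^ 2) mX'.lintegral_prod_right'
    rw [h, lintegral_prod _ mX'.lintegral_prod_right'.aemeasurable]
    calc ∫⁻ u, (∫⁻ t, (∫⁻ s, ‖X u s t‖ₑ ^ 2) ∂timeLaw g) ∂PX
        ≤ ∫⁻ u, (ENNReal.ofReal C * ∫⁻ s, ∫⁻ t, ‖X u s t‖ₑ ^ 2) ∂PX := by
          refine lintegral_mono fun u => (lintegral_mono' hle le_rfl).trans_eq ?_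
          rw [lintegral_smul_measure, smul_eq_mul, lintegral_lintegral_swap]
          exact ((hmodel.measurable_X.comp (measurable_const.prodMk
            measurable_swap)).enorm.pow_const 2).aemeasurable
      _ < ∞ := by
          rw [lintegral_const_mul' _ _ ENNReal.ofReal_ne_top]
          exact ENNReal.mul_lt_top ENNReal.ofReal_lt_top hX2
  have h2 : ∫⁻ z, (∫⁻ s, ‖e z.2.2 s‖ₑ ^ 2) ∂(visitLaw PX PE g) < ∞ := by
    have hmp : MeasurePreserving (fun z : 𝓧 × unitInterval × 𝓔 => z.2.2) (visitLaw PX PE g) PE :=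
      measurePreserving_snd.comp measurePreserving_snd
    have h := hmp.lintegral_comp (f := fun v => ∫⁻ s, ‖e v s‖ₑ ^ 2)
      (hmodel.measurable_e.enorm.pow_const 2).lintegral_prod_right'
    rwa [h]
  calc _ ≤ ∫⁻ z, 2 * ((∫⁻ s, ‖X z.1 s z.2.1‖ₑ ^ 2) + ∫⁻ s, ‖e z.2.2 s‖ₑ ^ 2)
        ∂(visitLaw PX PE g) := by
        refine lintegral_mono fun z => (lintegral_mono (hpt z)).trans_eq ?_
        rw [lintegral_const_mul' _ _ (by norm_num), lintegral_add_left]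
        exact (mX.comp measurable_prodMk_left).enorm.pow_const 2
    _ < ∞ := by
        rw [lintegral_const_mul' _ _ (by norm_num), lintegral_add_left]
        · exact ENNReal.mul_lt_top (by norm_num) (ENNReal.add_lt_top.2 ⟨h1, h2⟩)
        · exact (mX.enorm.pow_const 2).lintegral_prod_right'

omit [IsProbabilityMeasure μ] [IsProbabilityMeasure PX] [IsProbabilityMeasure PE] in
theorem measurable_pooledCov (n : ℕ) (ω : Ω) :
    Measurable (Function.uncurry (pooledCov (observedCurve X e x T ε) m n ω)) := by
  refine Measurable.div_const (Finset.measurable_sum _ fun i _ => Finset.measurable_sum _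
    fun j _ => ?_) _
  exact hmodel.measurable_visitCurve_mul.of_uncurry_left (x := (x i ω, T i j ω, ε i j ω))

/-- Measurability is read off from the representation of `Ξ` as a parameter integral of the jointly
measurable `y ⊗ y`. -/
theorem measurable_totalCov (hg : Continuous g) :
    Measurable (Function.uncurry (totalCov PX PE X e g)) := by
  have := hmodel.isProbabilityMeasure_timeLaw
  have h := (stronglyMeasurable_integral_left (Q := visitLaw PX PE g)
    hmodel.measurable_visitCurve_mul).measurable
  convert h using 1
  ext p
  exact (hmodel.integral_visitCurve_mul hg p.1 p.2).symm

/-- The total covariance is square integrable. -/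
theorem hsNorm_totalCov_lt_top (hg : Continuous g)
    (hX2 : (∫⁻ u, (∫⁻ s, ∫⁻ t, ‖X u s t‖ₑ ^ 2) ∂PX) < ∞)
    (hgb : BddAbove (Set.range fun t => |g t|))
    (he2 : (∫⁻ v, (∫⁻ s, ‖e v s‖ₑ ^ 2) ∂PE) < ∞) :
    hsNorm (totalCov PX PE X e g) < ∞ := by
  have := hmodel.isProbabilityMeasure_timeLaw
  rw [hsNorm_eq_eLpNorm (hmodel.measurable_totalCov hg)]
  have h := eLpNorm_two_integral_le (Q := visitLaw PX PE g)
    (ν := (volume : Measure unitInterval).prod volume) hmodel.measurable_visitCurve_mul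
  simp only [hmodel.integral_visitCurve_mul hg] at h
  refine lt_of_le_of_lt h ?_
  refine lt_of_eq_of_lt (lintegral_congr fun z => ?_)
    (hmodel.lintegral_visitCurve_sq_lt_top hX2 hgb he2)
  exact eLpNorm_two_tensor_self (hmodel.measurable_visitCurve.of_uncurry_left (x := z))

/-- The observed curves are square integrable almost surely. -/
theorem ae_observedCurve_sq_lt_top
    (hX2 : (∫⁻ u, (∫⁻ s, ∫⁻ t, ‖X u s t‖ₑ ^ 2) ∂PX) < ∞)
    (hgb : BddAbove (Set.range fun t => |g t|))
    (he2 : (∫⁻ v, (∫⁻ s, ‖e v s‖ₑ ^ 2) ∂PE) < ∞) :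
    ∀ᵐ ω ∂μ, ∀ i j, ∫⁻ s, ‖observedCurve X e x T ε i j ω s‖ₑ ^ 2 < ∞ := by
  rw [ae_all_iff]
  intro i
  rw [ae_all_iff]
  intro j
  have h := ae_lt_top ((hmodel.measurable_visitCurve.enorm.pow_const 2).lintegral_prod_right')
    (hmodel.lintegral_visitCurve_sq_lt_top hX2 hgb he2).ne
  exact (hmodel.measurePreserving_visit i j).quasiMeasurePreserving.ae h

/-- Pointwise consistency of the pooled sample covariance. -/
theorem tendstoInMeasure_pooledCov (hg : Continuous g) (s s' : unitInterval) :
    TendstoInMeasure μ (fun n ω => pooledCov (observedCurve X e x T ε) m n ω s s') atTop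
      (fun _ => totalCov PX PE X e g s s') := by
  have := hmodel.isProbabilityMeasure_timeLaw
  have h := tendstoInMeasure_clusterMean hmodel.one_le_m hmodel.sparse
    hmodel.measurePreserving_visit hmodel.indepFun_visit
    (hmodel.measurable_visitCurve_mul.of_uncurry_right (y := (s, s')))
    (hmodel.integrable_visitCurve_mul s s')
  simp only [hmodel.integral_visitCurve_mul hg] at h
  exact h

/-- Consistency of the pooled sample covariance in Hilbert–Schmidt norm. -/
theorem tendsto_measure_hsNorm_pooledCov_sub (hg : Continuous g)
    (hX2 : (∫⁻ u, (∫⁻ s, ∫⁻ t, ‖X u s t‖ₑ ^ 2) ∂PX) < ∞)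
    (hgb : BddAbove (Set.range fun t => |g t|))
    (he2 : (∫⁻ v, (∫⁻ s, ‖e v s‖ₑ ^ 2) ∂PE) < ∞) {δ : ℝ≥0∞} (hδ : 0 < δ) :
    Tendsto (fun n => μ {ω | δ ≤ hsNorm fun s s' =>
      pooledCov (observedCurve X e x T ε) m n ω s s' - totalCov PX PE X e g s s'})
      atTop (𝓝 0) := by
  have := hmodel.isProbabilityMeasure_timeLaw
  have h := tendsto_measure_eLpNorm_clusterMean_sub (Q := visitLaw PX PE g)
    (ν := (volume : Measure unitInterval).prod volume) hmodel.one_le_m hmodel.sparse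
    hmodel.measurePreserving_visit hmodel.indepFun_visit hmodel.measurable_visitCurve_mul
    (fun p => hmodel.integrable_visitCurve_mul p.1 p.2) ?_ hδ
  · simp only [hmodel.integral_visitCurve_mul hg] at h
    have heq : ∀ n ω, hsNorm (fun s s' =>
        pooledCov (observedCurve X e x T ε) m n ω s s' - totalCov PX PE X e g s s') =
        eLpNorm (Function.uncurry fun s s' =>
          pooledCov (observedCurve X e x T ε) m n ω s s' - totalCov PX PE X e g s s') 2
          (volume.prod volume) := fun n ω => hsNorm_eq_eLpNorm
        ((hmodel.measurable_pooledCov n ω).sub (hmodel.measurable_totalCov hg))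
    simp only [heq]
    exact h
  · refine (lt_of_eq_of_lt (lintegral_congr fun z => ?_)
      (hmodel.lintegral_visitCurve_sq_lt_top hX2 hgb he2)).ne
    exact eLpNorm_two_tensor_self (hmodel.measurable_visitCurve.of_uncurry_left (x := z))

end LongitudinalModel

/-! ### Perturbation of the spectral decomposition of a bounded operator -/

section spectral

variable {H : Type*} [NormedAddCommGroup H] [InnerProductSpace ℝ H]

/-- The orthonormal sequence `φ` consists of eigenvectors of `A` with eigenvalues
`lam 0 ≥ lam 1 ≥ … ≥ 0`, and `A` vanishes on its orthogonal complement. -/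
structure IsSpectralSequence (A : H →L[ℝ] H) (φ : ℕ → H) (lam : ℕ → ℝ) : Prop where
  orthonormal : Orthonormal ℝ φ
  antitone : Antitone lam
  nonneg : ∀ k, 0 ≤ lam k
  eigen : ∀ k, A (φ k) = lam k • φ k
  complete : ∀ f, (∀ k, inner ℝ (φ k) f = 0) → A f = 0

namespace IsSpectralSequence

variable {A B : H →L[ℝ] H} {φ φ' : ℕ → H} {lam lam' : ℕ → ℝ}

/-- The sequence `φ` need not span, so it is completed to a Hilbert basis; the added vectors are
orthogonal to every `φ l`, hence killed by `A`. Thus `A` is diagonal, with no appeal to compactness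
or self-adjointness. -/
theorem exists_hilbertBasis [CompleteSpace H] (h : IsSpectralSequence A φ lam) :
    ∃ (w : Set H) (b : HilbertBasis w ℝ H) (c : w → ℝ),
      (∀ i, (∃ l, b i = φ l ∧ c i = lam l) ∨ ((∀ l, inner ℝ (φ l) (b i) = 0) ∧ c i = 0)) ∧
      ∀ i f, inner ℝ (b i) (A f) = c i * inner ℝ (b i) f := by
  classical
  obtain ⟨w, b, hw, hb⟩ := h.orthonormal.toSubtypeRange.exists_hilbertBasis_extension
  have hcase : ∀ i : w, ∃ c : ℝ,
      (∃ l, b i = φ l ∧ c = lam l) ∨ ((∀ l, inner ℝ (φ l) (b i) = 0) ∧ c = 0) := by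
    intro i
    by_cases hi : ∃ l, b i = φ l
    · obtain ⟨l, hl⟩ := hi
      exact ⟨lam l, Or.inl ⟨l, hl, rfl⟩⟩
    · refine ⟨0, Or.inr ⟨fun l => ?_, rfl⟩⟩
      have hl : φ l = b ⟨φ l, hw ⟨l, rfl⟩⟩ := by rw [hb]
      rw [hl]
      refine b.orthonormal.inner_eq_zero fun heq => hi ⟨l, ?_⟩
      rw [hl, heq]
  choose c hc using hcase
  have hA : ∀ i, A (b i) = c i • b i := by
    intro i
    rcases hc i with ⟨l, h1, h2⟩ | ⟨h1, h2⟩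
    · rw [h1, h2, h.eigen]
    · rw [h.complete _ h1, h2, zero_smul]
  refine ⟨w, b, c, hc, fun i f => ?_⟩
  have hs : HasSum (fun j => inner ℝ (b i) (A (b.repr f j • b j))) (inner ℝ (b i) (A f)) :=
    (b.hasSum_repr f).mapL ((innerSL ℝ (b i)).comp A)
  refine hs.unique ?_
  have hv : c i * inner ℝ (b i) f = inner ℝ (b i) (A (b.repr f i • b i)) := by
    rw [map_smul, hA, inner_smul_right, inner_smul_right, real_inner_self_eq_norm_sq,
      b.orthonormal.1 i, b.repr_apply_apply]
    ring
  rw [hv]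
  refine hasSum_single i fun j hj => ?_
  rw [map_smul, hA, inner_smul_right, inner_smul_right, b.orthonormal.inner_eq_zero hj.symm]
  simp

/-- Upper half of the min-max principle: the coordinates that survive have coefficient `lam l` with
`l ≥ k`, or `0` on the added basis vectors, which is at most `lam k` by nonnegativity. -/
theorem inner_apply_le [CompleteSpace H] (h : IsSpectralSequence A φ lam) {k : ℕ} {f : H}
    (hf : ∀ l < k, inner ℝ (φ l) f = 0) : inner ℝ f (A f) ≤ lam k * ‖f‖ ^ 2 := by
  obtain ⟨w, b, c, hc, hA⟩ := h.exists_hilbertBasis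
  have h1 := b.hasSum_inner_mul_inner f (A f)
  have h2 := (b.hasSum_inner_mul_inner f f).mul_left (lam k)
  rw [real_inner_self_eq_norm_sq] at h2
  refine hasSum_le (fun i => ?_) h1 h2
  rw [hA, real_inner_comm f (b i)]
  have hsq : c i * inner ℝ f (b i) ^ 2 ≤ lam k * inner ℝ f (b i) ^ 2 := by
    rcases hc i with ⟨l, h3, h4⟩ | ⟨-, h4⟩
    · rcases lt_or_ge l k with hl | hl
      · rw [h3, real_inner_comm, hf l hl]
        simp
      · rw [h4]
        exact mul_le_mul_of_nonneg_right (h.antitone hl) (sq_nonneg _)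
    · rw [h4]
      exact mul_le_mul_of_nonneg_right (h.nonneg k) (sq_nonneg _)
  nlinarith [hsq]

/-- Lower half of the min-max principle, on the span of the first `k + 1` eigenvectors. -/
theorem le_inner_apply_sum (h : IsSpectralSequence A φ lam) {k : ℕ} (a : Fin (k + 1) → ℝ) :
    lam k * ‖∑ l, a l • φ l‖ ^ 2 ≤ inner ℝ (∑ l, a l • φ l) (A (∑ l, a l • φ l)) := by
  have ho : Orthonormal ℝ fun l : Fin (k + 1) => φ l := h.orthonormal.comp _ Fin.val_injective
  have hA : A (∑ l, a l • φ l) = ∑ l : Fin (k + 1), (a l * lam l) • φ l := by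
    simp only [map_sum, map_smul, h.eigen, smul_smul]
  rw [hA, ← real_inner_self_eq_norm_sq, ho.inner_sum, ho.inner_sum, Finset.mul_sum]
  refine Finset.sum_le_sum fun l _ => ?_
  have := mul_le_mul_of_nonneg_right (h.antitone (Nat.lt_succ_iff.1 l.2)) (sq_nonneg (a l))
  simp only [conj_trivial]
  nlinarith [this]

/-- Weyl's inequality. -/
theorem eigenvalue_le_add_opNorm_sub [CompleteSpace H] (hA : IsSpectralSequence A φ lam)
    (hB : IsSpectralSequence B φ' lam') (k : ℕ) : lam k ≤ lam' k + ‖A - B‖ := by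
  -- With `k` equations in `k + 1` unknowns, some nonzero combination of `φ 0, …, φ k` is orthogonal
  -- to `φ' 0, …, φ' (k - 1)`; both halves of min-max apply to it.
  set M : Matrix (Fin k) (Fin (k + 1)) ℝ := fun j l => inner ℝ (φ' j) (φ l)
  have hker : LinearMap.ker M.mulVecLin ≠ ⊥ := LinearMap.ker_ne_bot_of_finrank_lt (by simp)
  obtain ⟨a, ha, ha0⟩ := Submodule.exists_mem_ne_zero_of_ne_bot hker
  set f : H := ∑ l, a l • φ l with hf
  have hf0 : f ≠ 0 := by
    intro h0
    refine ha0 (funext fun l => ?_)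
    have ho : Orthonormal ℝ fun l : Fin (k + 1) => φ l :=
      hA.orthonormal.comp _ Fin.val_injective
    exact Fintype.linearIndependent_iff.1 ho.linearIndependent a h0 l
  have hperp : ∀ l < k, inner ℝ (φ' l) f = 0 := by
    intro l hl
    have := congrFun (LinearMap.mem_ker.1 ha) ⟨l, hl⟩
    rw [hf, inner_sum]
    rw [Matrix.mulVecLin_apply] at this
    simpa [Matrix.mulVec, dotProduct, M, inner_smul_right, mul_comm] using this
  have h1 : lam k * ‖f‖ ^ 2 ≤ inner ℝ f (A f) := hA.le_inner_apply_sum a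
  have h2 : inner ℝ f (B f) ≤ lam' k * ‖f‖ ^ 2 := hB.inner_apply_le hperp
  have h3 : inner ℝ f ((A - B) f) ≤ ‖A - B‖ * ‖f‖ ^ 2 := by
    refine (real_inner_le_norm _ _).trans ?_
    nlinarith [(A - B).le_opNorm f, norm_nonneg f]
  rw [sub_apply, inner_sub_right] at h3
  have hpos : 0 < ‖f‖ ^ 2 := pow_pos (norm_pos_iff.2 hf0) 2
  refine le_of_mul_le_mul_right ?_ hpos
  linarith

/-- Off `φ k`, the operator `A - lam k` is diagonal with entries of modulus at least `γ`. The
condition `γ ≤ lam k` covers the kernel directions outside the sequence, where the entry is `-lam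
k`. -/
theorem mul_norm_le_norm_apply_sub [CompleteSpace H] (h : IsSpectralSequence A φ lam) {k : ℕ}
    {γ : ℝ} (hγ0 : 0 ≤ γ) (hγ : γ ≤ lam k) (hgap : ∀ l, l ≠ k → γ ≤ |lam l - lam k|) {f : H}
    (hf : inner ℝ (φ k) f = 0) : γ * ‖f‖ ≤ ‖A f - lam k • f‖ := by
  obtain ⟨w, b, c, hc, hA⟩ := h.exists_hilbertBasis
  have h1 := (b.hasSum_inner_mul_inner f f).mul_left (γ ^ 2)
  have h2 := b.hasSum_inner_mul_inner (A f - lam k • f) (A f - lam k • f)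
  rw [real_inner_self_eq_norm_sq] at h1 h2
  have hle : γ ^ 2 * ‖f‖ ^ 2 ≤ ‖A f - lam k • f‖ ^ 2 := by
    refine hasSum_le (fun i => ?_) h1 h2
    rw [real_inner_comm (b i), real_inner_comm (b i), inner_sub_right, inner_smul_right, hA]
    have hsq : γ ^ 2 * inner ℝ (b i) f ^ 2 ≤ (c i - lam k) ^ 2 * inner ℝ (b i) f ^ 2 := by
      rcases hc i with ⟨l, h3, h4⟩ | ⟨-, h4⟩
      · rcases eq_or_ne l k with rfl | hl
        · rw [h3, hf]
          simp
        · refine mul_le_mul_of_nonneg_right ?_ (sq_nonneg _)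
          rw [h4, ← sq_abs (lam l - lam k)]
          exact pow_le_pow_left₀ hγ0 (hgap l hl) 2
      · refine mul_le_mul_of_nonneg_right ?_ (sq_nonneg _)
        rw [h4, zero_sub, neg_sq]
        exact pow_le_pow_left₀ hγ0 hγ 2
    nlinarith [hsq]
  rw [← mul_pow] at hle
  exact le_of_sq_le_sq hle (norm_nonneg _)

/-- Perturbation of an eigenvector whose eigenvalue is separated by a gap `γ` from the rest of the
spectrum. -/
theorem mul_norm_sub_le [CompleteSpace H] (hA : IsSpectralSequence A φ lam)
    (hB : IsSpectralSequence B φ' lam') {k : ℕ} {γ : ℝ} (hγ0 : 0 ≤ γ) (hγ : γ ≤ lam k)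
    (hgap : ∀ l, l ≠ k → γ ≤ |lam l - lam k|) (hsign : 0 ≤ inner ℝ (φ' k) (φ k)) :
    γ * ‖φ' k - φ k‖ ≤ 4 * ‖A - B‖ := by
  set a : ℝ := inner ℝ (φ' k) (φ k) with ha
  have hn : ‖φ k‖ = 1 := hA.orthonormal.1 k
  have hn' : ‖φ' k‖ = 1 := hB.orthonormal.1 k
  set r : H := φ' k - a • φ k with hr
  have hperp : inner ℝ (φ k) r = 0 := by
    rw [hr, inner_sub_right, inner_smul_right, real_inner_self_eq_norm_sq, hn, real_inner_comm, ← ha]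
    ring
  -- `A - lam k` kills `φ k`, so it acts on `r` as on `φ' k`. Both terms on the right have norm at
  -- most `‖A - B‖`, the second by Weyl's inequality.
  have hres : A r - lam k • r = (A - B) (φ' k) + (lam' k - lam k) • φ' k := by
    rw [hr, map_sub, map_smul, hA.eigen, sub_apply, hB.eigen]
    module
  have hlam : |lam' k - lam k| ≤ ‖A - B‖ := by
    rw [abs_le]
    have h1 := hA.eigenvalue_le_add_opNorm_sub hB k
    have h2 := hB.eigenvalue_le_add_opNorm_sub hA k
    rw [norm_sub_rev] at h2
    constructor <;> linarith
  have hrle : γ * ‖r‖ ≤ 2 * ‖A - B‖ := by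
    refine (hA.mul_norm_le_norm_apply_sub hγ0 hγ hgap hperp).trans ?_
    rw [hres]
    refine (norm_add_le _ _).trans ?_
    have h1 := (A - B).le_opNorm (φ' k)
    rw [norm_smul, Real.norm_eq_abs, hn', mul_one]
    rw [hn', mul_one] at h1
    linarith
  have hrsq : ‖r‖ ^ 2 = 1 - a ^ 2 := by
    rw [hr, norm_sub_sq_real, inner_smul_right, ← ha, norm_smul, hn, hn', Real.norm_eq_abs, mul_one,
      sq_abs]
    ring
  have hsq : ‖φ' k - φ k‖ ^ 2 = 2 - 2 * a := by
    rw [norm_sub_sq_real, ← ha, hn, hn']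
    ring
  -- This is `2(1 - a) ≤ 4(1 - a)(1 + a)`, valid as `0 ≤ a ≤ 1`; the sign convention supplies `0 ≤
  -- a`.
  have hle : ‖φ' k - φ k‖ ≤ 2 * ‖r‖ := by
    refine le_of_sq_le_sq ?_ (by positivity)
    have ha1 : 0 ≤ 1 - a := by nlinarith [sq_nonneg ‖φ' k - φ k‖]
    rw [hsq, mul_pow, hrsq]
    nlinarith
  nlinarith

/-- By monotonicity the nearest eigenvalues are the neighbours `k ± 1` (only `k + 1` when `k = 0`).
Since `lam (k + 1) ≥ 0`, the lower gap is at most `lam k`. -/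
theorem exists_gap (h : IsSpectralSequence A φ lam) {k : ℕ} (hk : ∀ l, l ≠ k → lam l ≠ lam k) :
    ∃ γ, 0 < γ ∧ γ ≤ lam k ∧ ∀ l, l ≠ k → γ ≤ |lam l - lam k| := by
  have h1 : 0 < lam k - lam (k + 1) :=
    sub_pos.2 (lt_of_le_of_ne (h.antitone k.le_succ) (hk _ k.succ_ne_self))
  have hup : ∀ l, k < l → lam k - lam (k + 1) ≤ |lam l - lam k| := fun l hl => by
    rw [abs_sub_comm]
    exact (sub_le_sub_left (h.antitone hl) _).trans (le_abs_self _)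
  have hle : lam k - lam (k + 1) ≤ lam k := sub_le_self _ (h.nonneg _)
  rcases k with _ | k
  · exact ⟨_, h1, hle, fun l hl => hup l (Nat.pos_of_ne_zero hl)⟩
  · have h2 : 0 < lam k - lam (k + 1) :=
      sub_pos.2 (lt_of_le_of_ne (h.antitone k.le_succ) (hk _ k.succ_ne_self.symm).symm)
    refine ⟨_, lt_min h1 h2, (min_le_left _ _).trans hle, fun l hl => ?_⟩
    rcases lt_or_gt_of_ne hl with hl | hl
    · refine (min_le_right _ _).trans (le_trans ?_ (le_abs_self _))
      exact sub_le_sub_right (h.antitone (Nat.lt_succ_iff.1 hl)) _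
    · exact (min_le_left _ _).trans (hup l hl)

end IsSpectralSequence

end spectral

/-! ### Integral operators with square integrable kernels -/

section kernel

variable {S : Type*} [MeasurableSpace S] {ν : Measure S} [SFinite ν]

theorem ae_memLp_kernel {k : S → S → ℝ} (hk : Measurable (Function.uncurry k))
    (hfin : eLpNorm (Function.uncurry k) 2 (ν.prod ν) < ∞) : ∀ᵐ s ∂ν, MemLp (k s) 2 ν := by
  have h : ∫⁻ s, ∫⁻ s', ‖k s s'‖ₑ ^ 2 ∂ν ∂ν ≠ ∞ := by
    have := ENNReal.pow_lt_top hfin (n := 2)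
    rw [eLpNorm_two_sq, lintegral_prod _ (hk.enorm.pow_const 2).aemeasurable] at this
    exact this.ne
  filter_upwards [ae_lt_top (hk.enorm.pow_const 2).lintegral_prod_right' h] with s hs
  refine ⟨hk.of_uncurry_left.aestronglyMeasurable, ?_⟩
  rw [eLpNorm_lt_top_iff_lintegral_rpow_enorm_lt_top two_ne_zero ENNReal.ofNat_ne_top]
  simpa using hs

omit [SFinite ν] in
theorem enorm_integral_mul_le {y f : S → ℝ} (hy : AEMeasurable y ν) (hf : AEMeasurable f ν) :
    ‖∫ s, y s * f s ∂ν‖ₑ ≤ eLpNorm y 2 ν * eLpNorm f 2 ν := by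
  refine (enorm_integral_le_lintegral_enorm _).trans ?_
  have := ENNReal.lintegral_mul_le_Lp_mul_Lq ν Real.HolderConjugate.two_two hy.enorm hf.enorm
  simpa [eLpNorm_eq_lintegral_rpow_enorm_toReal] using this

/-- The operator norm is at most the Hilbert–Schmidt norm. -/
theorem eLpNorm_integral_kernel_le {k : S → S → ℝ} (hk : Measurable (Function.uncurry k))
    {f : S → ℝ} (hf : Measurable f) :
    eLpNorm (fun s => ∫ s', k s s' * f s' ∂ν) 2 ν ≤
      eLpNorm (Function.uncurry k) 2 (ν.prod ν) * eLpNorm f 2 ν := by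
  rw [← ENNReal.pow_le_pow_left_iff two_ne_zero]
  rw [mul_pow, eLpNorm_two_sq, eLpNorm_two_sq (ν := ν.prod ν),
    lintegral_prod _ (hk.enorm.pow_const 2).aemeasurable]
  calc ∫⁻ s, ‖∫ s', k s s' * f s' ∂ν‖ₑ ^ 2 ∂ν
      ≤ ∫⁻ s, (∫⁻ s', ‖k s s'‖ₑ ^ 2 ∂ν) * eLpNorm f 2 ν ^ 2 ∂ν := by
        refine lintegral_mono fun s => ?_
        rw [← eLpNorm_two_sq, ← mul_pow]
        gcongr
        exact enorm_integral_mul_le hk.of_uncurry_left.aemeasurable hf.aemeasurable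
    _ = _ := by
        rw [lintegral_mul_const]
        · rfl
        · exact (hk.enorm.pow_const 2).lintegral_prod_right'

theorem memLp_integral_kernel {k : S → S → ℝ} (hk : Measurable (Function.uncurry k))
    (hfin : eLpNorm (Function.uncurry k) 2 (ν.prod ν) < ∞) (f : Lp ℝ 2 ν) :
    MemLp (fun s => ∫ s', k s s' * f s' ∂ν) 2 ν := by
  have hf : Measurable f := (Lp.stronglyMeasurable f).measurable
  refine ⟨?_, (eLpNorm_integral_kernel_le hk hf).trans_lt
    (ENNReal.mul_lt_top hfin (Lp.eLpNorm_lt_top f))⟩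
  have hm : Measurable fun q : S × S => k q.1 q.2 * f q.2 := hk.mul (hf.comp measurable_snd)
  exact (hm.stronglyMeasurable.integral_prod_right').aestronglyMeasurable

/-- The integral operator on `L²(ν)` with a square integrable kernel. -/
def kernelOp {k : S → S → ℝ} (hk : Measurable (Function.uncurry k))
    (hfin : eLpNorm (Function.uncurry k) 2 (ν.prod ν) < ∞) : Lp ℝ 2 ν →L[ℝ] Lp ℝ 2 ν :=
  LinearMap.mkContinuous
    { toFun := fun f => (memLp_integral_kernel hk hfin f).toLp
      map_add' := fun f f' => by
        rw [← MemLp.toLp_add]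
        refine MemLp.toLp_congr _ _ ?_
        -- Splitting the integral requires the row `k s` to be in `L²`, which holds only for almost
        -- every `s`.
        filter_upwards [ae_memLp_kernel hk hfin] with s hs
        refine Eq.trans (integral_congr_ae ?_) (integral_add (hs.integrable_mul (Lp.memLp f))
          (hs.integrable_mul (Lp.memLp f')))
        filter_upwards [Lp.coeFn_add f f'] with s' hs'
        simp only [hs', Pi.add_apply, mul_add]
      map_smul' := fun c f => by
        rw [RingHom.id_apply, ← MemLp.toLp_const_smul]
        refine MemLp.toLp_congr _ _ (ae_of_all _ fun s => ?_)
        rw [Pi.smul_apply, ← integral_smul]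
        refine integral_congr_ae ?_
        filter_upwards [Lp.coeFn_smul c f] with s' hs'
        simp only [hs', Pi.smul_apply, smul_eq_mul]
        ring }
    (eLpNorm (Function.uncurry k) 2 (ν.prod ν)).toReal fun f => by
      rw [LinearMap.coe_mk, AddHom.coe_mk, Lp.norm_toLp, Lp.norm_def, ← ENNReal.toReal_mul]
      exact ENNReal.toReal_mono (ENNReal.mul_ne_top hfin.ne (Lp.eLpNorm_ne_top f))
        (eLpNorm_integral_kernel_le hk (Lp.stronglyMeasurable f).measurable)

theorem coeFn_kernelOp {k : S → S → ℝ} (hk : Measurable (Function.uncurry k))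
    (hfin : eLpNorm (Function.uncurry k) 2 (ν.prod ν) < ∞) (f : Lp ℝ 2 ν) :
    kernelOp hk hfin f =ᵐ[ν] fun s => ∫ s', k s s' * f s' ∂ν :=
  MemLp.coeFn_toLp (memLp_integral_kernel hk hfin f)

/-- The difference of the two operators is almost everywhere given by the difference kernel, to
which the Hilbert–Schmidt bound applies. -/
theorem norm_kernelOp_sub_le {k k' : S → S → ℝ} (hk : Measurable (Function.uncurry k))
    (hfin : eLpNorm (Function.uncurry k) 2 (ν.prod ν) < ∞)
    (hk' : Measurable (Function.uncurry k'))
    (hfin' : eLpNorm (Function.uncurry k') 2 (ν.prod ν) < ∞) :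
    ENNReal.ofReal ‖kernelOp hk hfin - kernelOp hk' hfin'‖ ≤
      eLpNorm (Function.uncurry fun s s' => k s s' - k' s s') 2 (ν.prod ν) := by
  set D := eLpNorm (Function.uncurry fun s s' => k s s' - k' s s') 2 (ν.prod ν)
  by_cases hDt : D = ∞
  · rw [hDt]
    exact le_top
  rw [ENNReal.ofReal_le_iff_le_toReal hDt]
  refine ContinuousLinearMap.opNorm_le_bound _ ENNReal.toReal_nonneg fun f => ?_
  have hae : ⇑((kernelOp hk hfin - kernelOp hk' hfin') f) =ᵐ[ν]
      fun s => ∫ s', (k s s' - k' s s') * f s' ∂ν := by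
    rw [sub_apply]
    filter_upwards [Lp.coeFn_sub (kernelOp hk hfin f) (kernelOp hk' hfin' f),
      coeFn_kernelOp hk hfin f, coeFn_kernelOp hk' hfin' f, ae_memLp_kernel hk hfin,
      ae_memLp_kernel hk' hfin'] with s h1 h2 h3 h4 h5
    rw [h1, Pi.sub_apply, h2, h3]
    refine (integral_sub (h4.integrable_mul (Lp.memLp f))
      (h5.integrable_mul (Lp.memLp f))).symm.trans ?_
    refine integral_congr_ae (ae_of_all _ fun s' => ?_)
    simp only [Pi.mul_apply, sub_mul]
  rw [Lp.norm_def, Lp.norm_def, ← ENNReal.toReal_mul, eLpNorm_congr_ae hae]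
  exact ENNReal.toReal_mono (ENNReal.mul_ne_top hDt (Lp.eLpNorm_ne_top f))
    (eLpNorm_integral_kernel_le (hk.sub hk') (Lp.stronglyMeasurable f).measurable)

end kernel

/-! ### Continuity of eigenfunctions and scores -/

theorem IsSpectralDecomposition.isSpectralSequence {K : unitInterval → unitInterval → ℝ}
    {φ : ℕ → Lp ℝ 2 (volume : Measure unitInterval)} {lam : ℕ → ℝ}
    (h : IsSpectralDecomposition K φ lam) (hK : Measurable (Function.uncurry K))
    (hfin : eLpNorm (Function.uncurry K) 2 (volume.prod volume) < ∞) :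
    IsSpectralSequence (kernelOp hK hfin) φ lam where
  orthonormal := h.orthonormal
  antitone := h.antitone
  nonneg := h.nonneg
  eigen k := by
    refine Lp.ext ?_
    filter_upwards [coeFn_kernelOp hK hfin (φ k), Lp.coeFn_smul (lam k) (φ k), h.eigen k]
      with s h1 h2 h3
    rw [h1, h2, h3, Pi.smul_apply, smul_eq_mul]
  complete f hf := by
    refine Lp.ext ?_
    filter_upwards [coeFn_kernelOp hK hfin f, Lp.coeFn_zero ℝ 2 (volume : Measure unitInterval),
      h.complete f hf] with s h1 h2 h3
    rw [h1, h2, h3, Pi.zero_apply]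

/-- Eigenfunctions of simple eigenvalues depend continuously on the kernel. -/
theorem IsSpectralDecomposition.exists_forall_ofReal_norm_sub_le
    {K : unitInterval → unitInterval → ℝ}
    {φ : ℕ → Lp ℝ 2 (volume : Measure unitInterval)} {lam : ℕ → ℝ}
    (h : IsSpectralDecomposition K φ lam) (hK : Measurable (Function.uncurry K))
    (hfin : hsNorm K < ∞) {k : ℕ} (hk : ∀ l, l ≠ k → lam l ≠ lam k) :
    ∃ C : ℝ, 0 < C ∧ ∀ (K' : unitInterval → unitInterval → ℝ)
      (φ' : ℕ → Lp ℝ 2 (volume : Measure unitInterval)) (lam' : ℕ → ℝ),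
      Measurable (Function.uncurry K') → IsSpectralDecomposition K' φ' lam' →
      0 ≤ inner ℝ (φ' k) (φ k) →
      ENNReal.ofReal (C * ‖φ' k - φ k‖) ≤ hsNorm fun s s' => K' s s' - K s s' := by
  rw [hsNorm_eq_eLpNorm hK] at hfin
  have hA := h.isSpectralSequence hK hfin
  obtain ⟨γ, hγ0, hγ, hgap⟩ := hA.exists_gap hk
  refine ⟨γ / 4, by positivity, fun K' φ' lam' hK' h' hsign => ?_⟩
  have hsub : Measurable (Function.uncurry fun s s' => K' s s' - K s s') := hK'.sub hK
  rw [hsNorm_eq_eLpNorm hsub]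
  -- The claim is trivial at infinite distance. Otherwise `K' = (K' - K) + K` is square integrable,
  -- so square integrability of `K'` need not be assumed.
  by_cases hDt : eLpNorm (Function.uncurry fun s s' => K' s s' - K s s') 2
      (volume.prod volume) = ∞
  · rw [hDt]
    exact le_top
  have hfin' : eLpNorm (Function.uncurry K') 2 (volume.prod volume) < ∞ := by
    have heq : Function.uncurry K' =
        (Function.uncurry fun s s' => K' s s' - K s s') + Function.uncurry K := by
      ext p
      simp [Function.uncurry]
    rw [heq]
    exact (eLpNorm_add_le hsub.aestronglyMeasurable hK.aestronglyMeasurable one_le_two).trans_lt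
      (ENNReal.add_lt_top.2 ⟨lt_top_iff_ne_top.2 hDt, hfin⟩)
  have hB := h'.isSpectralSequence hK' hfin'
  have hle := hA.mul_norm_sub_le hB hγ0.le hγ hgap hsign
  refine le_trans (ENNReal.ofReal_le_ofReal ?_) (norm_kernelOp_sub_le hK' hfin' hK hfin)
  rw [norm_sub_rev (kernelOp hK' hfin')]
  linarith

theorem abs_score_sub_le {y : unitInterval → ℝ} (hy : MemLp y 2 volume)
    (φ φ' : Lp ℝ 2 (volume : Measure unitInterval)) :
    |score y φ' - score y φ| ≤ (eLpNorm y 2 volume).toReal * ‖φ' - φ‖ := by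
  have heq : score y φ' - score y φ = ∫ s, y s * (φ' - φ) s := by
    refine (integral_sub (hy.integrable_mul (Lp.memLp φ'))
      (hy.integrable_mul (Lp.memLp φ))).symm.trans (integral_congr_ae ?_)
    filter_upwards [Lp.coeFn_sub φ' φ] with s hs
    simp only [hs, Pi.mul_apply, Pi.sub_apply, mul_sub]
  have h := enorm_integral_mul_le hy.1.aemeasurable
    (Lp.stronglyMeasurable (φ' - φ)).measurable.aemeasurable
  rw [heq, Lp.norm_def, ← ENNReal.toReal_mul, ← Real.norm_eq_abs, ← toReal_enorm]
  exact ENNReal.toReal_mono (ENNReal.mul_ne_top hy.2.ne (Lp.eLpNorm_ne_top _)) h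

/-! ### Products of a tight factor and a sequence vanishing in probability -/

/-- A sequence dominated by `R * a n`, where `a n → 0` in probability, tends to zero in
probability. -/
theorem tendstoInMeasure_zero_of_le_mul {Ω : Type*} [MeasurableSpace Ω] {μ : Measure Ω}
    [IsFiniteMeasure μ] {R : Ω → ℝ} (hR : Measurable R) {a b : ℕ → Ω → ℝ}
    (ha0 : ∀ n ω, 0 ≤ a n ω) (hb0 : ∀ n ω, 0 ≤ b n ω)
    (ha : ∀ η : ℝ, 0 < η → Tendsto (fun n => μ {ω | η ≤ a n ω}) atTop (𝓝 0))
    (hb : ∀ n, ∀ᵐ ω ∂μ, b n ω ≤ R ω * a n ω) :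
    TendstoInMeasure μ b atTop fun _ => 0 := by
  -- `R` is real valued, so the events `c ≤ R` decrease to the empty set.
  have htight : Tendsto (fun c : ℕ => μ {ω | (c : ℝ) ≤ R ω}) atTop (𝓝 0) := by
    have h := tendsto_measure_iInter_atTop (μ := μ) (s := fun c : ℕ => {ω | (c : ℝ) ≤ R ω})
      (fun c => (measurableSet_le measurable_const hR).nullMeasurableSet)
      (fun c d hcd ω (hω : (d : ℝ) ≤ R ω) => le_trans (Nat.cast_le.2 hcd) hω)
      ⟨0, measure_ne_top _ _⟩
    have hempty : ⋂ c : ℕ, {ω | (c : ℝ) ≤ R ω} = ∅ := by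
      refine Set.eq_empty_iff_forall_notMem.2 fun ω hω => ?_
      obtain ⟨c, hc⟩ := exists_nat_gt (R ω)
      exact absurd (Set.mem_iInter.1 hω c) (not_le.2 hc)
    rwa [hempty, measure_empty] at h
  rw [tendstoInMeasure_iff_norm]
  intro δ hδ
  rw [ENNReal.tendsto_nhds_zero]
  intro κ hκ
  obtain ⟨c, hcκ, hc⟩ := ((ENNReal.tendsto_nhds_zero.1 htight (κ / 2)
    (ENNReal.half_pos hκ.ne')).and (eventually_ge_atTop 1)).exists
  have hc0 : (0 : ℝ) < c := Nat.cast_pos.2 hc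
  filter_upwards [ENNReal.tendsto_nhds_zero.1 (ha (δ / c) (by positivity)) (κ / 2)
    (ENNReal.half_pos hκ.ne')] with n hn
  -- Where `R < c`, one has `δ ≤ b ≤ R a ≤ c a`. Monotonicity and subadditivity suffice, so `a` and
  -- `b` need not be measurable; this allows arbitrary choices of `φhat`.
  calc μ {ω | δ ≤ ‖b n ω - 0‖} ≤ μ ({ω | (c : ℝ) ≤ R ω} ∪ {ω | δ / c ≤ a n ω}) := by
        refine measure_mono_ae ?_
        filter_upwards [hb n] with ω hω (hδb : δ ≤ ‖b n ω - 0‖)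
        rw [sub_zero, Real.norm_of_nonneg (hb0 n ω)] at hδb
        rcases le_or_gt (c : ℝ) (R ω) with h | h
        · exact Or.inl h
        · refine Or.inr ((div_le_iff₀ hc0).2 ?_)
          nlinarith [ha0 n ω]
    _ ≤ κ / 2 + κ / 2 := (measure_union_le _ _).trans (add_le_add hcκ hn)
    _ = κ := ENNReal.add_halves κ

/-! ### Consistency of eigenfunctions and proxy scores -/

namespace LongitudinalModel

variable {Ω 𝓧 𝓔 : Type*}
    [MeasurableSpace Ω] [MeasurableSpace 𝓧] [MeasurableSpace 𝓔]
    {μ : Measure Ω} [IsProbabilityMeasure μ]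
    {PX : Measure 𝓧} [IsProbabilityMeasure PX] {PE : Measure 𝓔} [IsProbabilityMeasure PE]
    {X : 𝓧 → unitInterval → unitInterval → ℝ} {e : 𝓔 → unitInterval → ℝ}
    {g : unitInterval → ℝ} {m : ℕ → ℕ}
    {x : ℕ → Ω → 𝓧} {T : ℕ → ℕ → Ω → unitInterval} {ε : ℕ → ℕ → Ω → 𝓔}
    (hmodel : LongitudinalModel μ PX PE X e g m x T ε)
include hmodel

/-- Consistency of the estimated eigenfunctions of simple eigenvalues. -/
theorem tendsto_measure_norm_eigenfunction_sub (hg : Continuous g)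
    (hX2 : (∫⁻ u, (∫⁻ s, ∫⁻ t, ‖X u s t‖ₑ ^ 2) ∂PX) < ∞)
    (hgb : BddAbove (Set.range fun t => |g t|))
    (he2 : (∫⁻ v, (∫⁻ s, ‖e v s‖ₑ ^ 2) ∂PE) < ∞)
    {φ : ℕ → Lp ℝ 2 (volume : Measure unitInterval)} {lam : ℕ → ℝ}
    {φhat : ℕ → Ω → ℕ → Lp ℝ 2 (volume : Measure unitInterval)} {lamhat : ℕ → Ω → ℕ → ℝ}
    (hφ : IsSpectralDecomposition (totalCov PX PE X e g) φ lam)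
    (hφhat : ∀ n, ∀ᵐ ω ∂μ, IsSpectralDecomposition
      (pooledCov (observedCurve X e x T ε) m n ω) (φhat n ω) (lamhat n ω))
    {k : ℕ} (hk : ∀ l, l ≠ k → lam l ≠ lam k)
    (hsign : ∀ n, ∀ᵐ ω ∂μ, 0 ≤ inner ℝ (φhat n ω k) (φ k)) {η : ℝ} (hη : 0 < η) :
    Tendsto (fun n => μ {ω | η ≤ ‖φhat n ω k - φ k‖}) atTop (𝓝 0) := by
  obtain ⟨C, hC, hCle⟩ := hφ.exists_forall_ofReal_norm_sub_le (hmodel.measurable_totalCov hg)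
    (hmodel.hsNorm_totalCov_lt_top hg hX2 hgb he2) hk
  refine tendsto_of_tendsto_of_tendsto_of_le_of_le tendsto_const_nhds
    (hmodel.tendsto_measure_hsNorm_pooledCov_sub hg hX2 hgb he2
      (ENNReal.ofReal_pos.2 (mul_pos hC hη))) (fun _ => zero_le) fun n => measure_mono_ae ?_
  filter_upwards [hφhat n, hsign n] with ω h1 h2 (h3 : η ≤ ‖φhat n ω k - φ k‖)
  refine le_trans (ENNReal.ofReal_le_ofReal ?_)
    (hCle _ _ _ (hmodel.measurable_pooledCov n ω) h1 h2)
  gcongr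

/-- Consistency of the proxy scores of a subject. -/
theorem tendstoInMeasure_iSup_abs_score_sub (hg : Continuous g)
    (hX2 : (∫⁻ u, (∫⁻ s, ∫⁻ t, ‖X u s t‖ₑ ^ 2) ∂PX) < ∞)
    (hgb : BddAbove (Set.range fun t => |g t|))
    (he2 : (∫⁻ v, (∫⁻ s, ‖e v s‖ₑ ^ 2) ∂PE) < ∞)
    {φ : ℕ → Lp ℝ 2 (volume : Measure unitInterval)} {lam : ℕ → ℝ}
    {φhat : ℕ → Ω → ℕ → Lp ℝ 2 (volume : Measure unitInterval)} {lamhat : ℕ → Ω → ℕ → ℝ}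
    (hφ : IsSpectralDecomposition (totalCov PX PE X e g) φ lam)
    (hφhat : ∀ n, ∀ᵐ ω ∂μ, IsSpectralDecomposition
      (pooledCov (observedCurve X e x T ε) m n ω) (φhat n ω) (lamhat n ω))
    {k : ℕ} (hk : ∀ l, l ≠ k → lam l ≠ lam k)
    (hsign : ∀ n, ∀ᵐ ω ∂μ, 0 ≤ inner ℝ (φhat n ω k) (φ k)) (i : ℕ) :
    TendstoInMeasure μ (fun n ω => ⨆ j : Fin (m i),
      |score (observedCurve X e x T ε i j ω) (φhat n ω k) -
        score (observedCurve X e x T ε i j ω) (φ k)|) atTop (fun _ => 0) := by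
  have hY : ∀ j, Measurable (Function.uncurry (observedCurve X e x T ε i j)) := fun j =>
    hmodel.measurable_visitCurve.comp
      (((hmodel.measurePreserving_visit i j).measurable.comp measurable_fst).prodMk measurable_snd)
  have hne : Nonempty (Fin (m i)) := ⟨⟨0, hmodel.one_le_m i⟩⟩
  refine tendstoInMeasure_zero_of_le_mul
    -- The finite sum dominates each curve norm and does not depend on `n`; almost surely the norms
    -- are finite, so `toReal` loses nothing.
    (R := fun ω => ∑ j : Fin (m i), (eLpNorm (observedCurve X e x T ε i j ω) 2 volume).toReal)
    (a := fun n ω => ‖φhat n ω k - φ k‖)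
    (Finset.measurable_sum _ fun j _ => (measurable_eLpNorm_two (hY j)).ennreal_toReal)
    (fun n ω => norm_nonneg _) (fun n ω => Real.iSup_nonneg fun j => abs_nonneg _)
    (fun η hη => hmodel.tendsto_measure_norm_eigenfunction_sub hg hX2 hgb he2 hφ hφhat hk hsign hη)
    fun n => ?_
  filter_upwards [hmodel.ae_observedCurve_sq_lt_top hX2 hgb he2] with ω hω
  refine ciSup_le fun j => ?_
  have hmem : MemLp (observedCurve X e x T ε i j ω) 2 volume := by
    refine ⟨(hY j).of_uncurry_left.aestronglyMeasurable, ?_⟩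
    rw [eLpNorm_lt_top_iff_lintegral_rpow_enorm_lt_top two_ne_zero ENNReal.ofNat_ne_top]
    simpa using hω i j
  refine (abs_score_sub_le hmem _ _).trans (mul_le_mul_of_nonneg_right ?_ (norm_nonneg _))
  exact Finset.single_le_sum (f := fun j : Fin (m i) =>
    (eLpNorm (observedCurve X e x T ε i j ω) 2 volume).toReal)
    (fun j _ => ENNReal.toReal_nonneg) (Finset.mem_univ j)

end LongitudinalModel

end

theorem corollary3 {Ω 𝓧 𝓔 : Type*}
    [MeasurableSpace Ω] [MeasurableSpace 𝓧] [MeasurableSpace 𝓔]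
    (μ : Measure Ω) [IsProbabilityMeasure μ]
    (PX : Measure 𝓧) [IsProbabilityMeasure PX] (PE : Measure 𝓔) [IsProbabilityMeasure PE]
    (X : 𝓧 → unitInterval → unitInterval → ℝ) (e : 𝓔 → unitInterval → ℝ)
    (g : unitInterval → ℝ) (m : ℕ → ℕ)
    (x : ℕ → Ω → 𝓧) (T : ℕ → ℕ → Ω → unitInterval) (ε : ℕ → ℕ → Ω → 𝓔)
    (hmodel : LongitudinalModel μ PX PE X e g m x T ε)
    -- `E ∬ X² < ∞`
    (hX2 : (∫⁻ u, (∫⁻ s, ∫⁻ t, ‖X u s t‖ₑ ^ 2) ∂PX) < ∞)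
    -- the sampling density is continuous and bounded
    (hg : Continuous g) (hgb : BddAbove (Set.range fun t => |g t|))
    -- `E ∫ e² < ∞`
    (he2 : (∫⁻ v, (∫⁻ s, ‖e v s‖ₑ ^ 2) ∂PE) < ∞) :
    -- pointwise consistency
    ((∀ s s' t t', Integrable (fun u => X u s t * X u s' t * X u s t' * X u s' t') PX) →
      ∀ s s', TendstoInMeasure μ
        (fun n ω => pooledCov (observedCurve X e x T ε) m n ω s s') atTop
        (fun _ => totalCov PX PE X e g s s')) ∧
    -- consistency in Hilbert–Schmidt norm, and consistency of the scores,
    -- under `E ‖X(·,t)‖⁴ < ∞` for each `t` and `E ‖e‖⁴ < ∞`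
    ((∀ t, (∫⁻ u, (∫⁻ s, ‖X u s t‖ₑ ^ 2) ^ 2 ∂PX) < ∞) →
      (∫⁻ v, (∫⁻ s, ‖e v s‖ₑ ^ 2) ^ 2 ∂PE) < ∞ →
      (∀ δ : ℝ≥0∞, 0 < δ → Tendsto (fun n => μ {ω | δ ≤ hsNorm fun s s' =>
          pooledCov (observedCurve X e x T ε) m n ω s s' - totalCov PX PE X e g s s'})
        atTop (𝓝 0)) ∧
      ∀ (φ : ℕ → Lp ℝ 2 (volume : Measure unitInterval)) (lam : ℕ → ℝ)
        (φhat : ℕ → Ω → ℕ → Lp ℝ 2 (volume : Measure unitInterval)) (lamhat : ℕ → Ω → ℕ → ℝ),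
        IsSpectralDecomposition (totalCov PX PE X e g) φ lam →
        (∀ n, ∀ᵐ ω ∂μ, IsSpectralDecomposition
          (pooledCov (observedCurve X e x T ε) m n ω) (φhat n ω) (lamhat n ω)) →
        ∀ k, (∀ l, l ≠ k → lam l ≠ lam k) →
          -- the sign of the estimated eigenfunction is chosen to match that of `φ k`
          (∀ n, ∀ᵐ ω ∂μ, 0 ≤ inner ℝ (φhat n ω k) (φ k)) →
          ∀ i, TendstoInMeasure μ
            (fun n ω => ⨆ j : Fin (m i),
              |score (observedCurve X e x T ε i j ω) (φhat n ω k) -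
                score (observedCurve X e x T ε i j ω) (φ k)|) atTop
            (fun _ => 0)) := by
  refine ⟨fun _ s s' => hmodel.tendstoInMeasure_pooledCov hg s s', fun _ _ =>
    ⟨fun δ hδ => hmodel.tendsto_measure_hsNorm_pooledCov_sub hg hX2 hgb he2 hδ, ?_⟩⟩
  intro φ lam φhat lamhat hφ hφhat k hk hsign i
  exact hmodel.tendstoInMeasure_iSup_abs_score_sub hg hX2 hgb he2 hφ hφhat hk hsign i
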